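/- Conventions. All graphs are finite and simple. For $\theta_0>\theta_1>\theta_2$, $\mathscr G_3(\theta_0,\theta_1,\theta_2)$ is the set of connected graphs whose adjacency matrix has exactly the distinct eigenvalues $\theta_0,\theta_1,\theta_2$. The *coherent rank* of a graph is the dimension of its coherent closure, the smallest subalgebra of the complex matrices indexed by its vertices that contains $I$, the all-ones matrix $J$ and the adjacency matrix and is closed under transposition and the entrywise product. A *QSD* $\mathcal Q$ with parameters $(v,k,\lambda;b,r,\{x,y\})$ consists of $v$ points and a family of $b$ blocks (repeated blocks allowed), each block being a set of $k\ge 1$ points, such that every point is in exactly $r$ blocks, every pair of distinct points is in exactly $\lambda$ blocks, and any two distinct members of the family meet in $x$ or $y$ points, where $x\ne y$ and both numbers occur. The block graph $\mathsf B_x(\mathcal Q)$ has the blocks as vertices, two distinct members of the family being adjacent when they meet in exactly $x$ points; the total graph $\mathsf T_x(\mathcal Q)$ is the graph on points and blocks with adjacency matrix $\begin{bmatrix} O & M\\ M^\top & X\end{bmatrix}$, where $M$ is the points-by-blocks incidence matrix of $\mathcal Q$ and $X$ is the adjacency matrix of $\mathsf B_x(\mathcal Q)$. If $\Gamma$ has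 exactly two distinct degrees, with degree classes $V_1$ and $V_2$, then $\mathcal Q$ is the *underlying QSD* of $\Gamma$ if $\Gamma[V_1]$ is empty or complete and the points and blocks of $\mathcal Q$ can be identified with $V_1$ and $V_2$ so that the adjacency between $V_1$ and $V_2$ is the incidence of $\mathcal Q$ and $\Gamma[V_2]=\mathsf B_x(\mathcal Q)$. Let $$f_2(w,z)=\frac{w(w^2+w+1)-2z(w+1)+w\sqrt{(w^2+w+1)^2-4wz(w+1)}}{2}.$$ **Lemma.** Let $\Gamma\in\mathscr G_3(\theta_0,\theta_1,\theta_2)$ have coherent rank $9$. Suppose that the underlying QSD $\mathcal Q$ of $\Gamma$ has parameters $(v,k,\lambda;b,r,\{x,y\})$ and that $\mathsf B_x(\mathcal Q)$ has exactly the distinct eigenvalues $e_0>e_1>e_2$. Suppose that $\Gamma[V_1]$ is empty and $\theta_1=e_1=\frac{y-k}{x-y}$. Then $\theta_0=f_2(\theta_1,\theta_2)$, $e_0=\theta_0+\theta_2$, $e_2=\theta_1+\theta_2$, and $$v=\frac{-\theta_2(\theta_0-\theta_1)}{\lambda},\quad k=y+\theta_1^2,\quad \lambda=\frac{-\theta_2(x-1)}{\theta_1},\quad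 b=r-k+e_0+1,$$ $$r=\lambda-\theta_1\theta_2,\quad x=y-\theta_1,\quad y=\frac{e_0-\theta_1^3+\theta_1\theta_2}{\theta_1}.\qquad(*)$$ Conversely, let $\theta_1\ge 1$ and $\theta_2\le -2$ be integers, and let $\mathcal Q$ be a QSD whose parameters $(v,k,\lambda;b,r,\{x,y\})$ satisfy $(*)$ with $\theta_0=f_2(\theta_1,\theta_2)$ and $e_0=f_2(\theta_1,\theta_2)+\theta_2$. Then $\mathsf T_x(\mathcal Q)\in\mathscr G_3(f_2(\theta_1,\theta_2),\theta_1,\theta_2)$. Furthermore, if $r\neq k+f_2(\theta_1,\theta_2)+\theta_2$, then $\mathsf T_x(\mathcal Q)$ has coherent rank $9$. -/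

import Mathlib

noncomputable section

/-! Graphs with three distinct eigenvalues -/

open Classical in
/-- The set of eigenvalues of the (real) adjacency matrix of a finite graph. -/
def graphEigenvalues {V : Type*} [Fintype V] (G : SimpleGraph V) : Set ℝ :=
  spectrum ℝ (G.adjMatrix ℝ)

/-- `G` is connected and has exactly the three distinct eigenvalues `θ₀ > θ₁ > θ₂`. -/
structure InG3 {V : Type*} [Fintype V] (G : SimpleGraph V) (θ₀ θ₁ θ₂ : ℝ) : Prop where
  connected : G.Connected
  gt₀₁ : θ₀ > θ₁
  gt₁₂ : θ₁ > θ₂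
  eigenvalues_eq : graphEigenvalues G = {θ₀, θ₁, θ₂}

/-! Coherent algebras and the coherent rank -/

open Classical in
/-- A coherent algebra: a subalgebra of `Mat_V(ℂ)` (so it contains `I`) that contains the all-ones
matrix and is closed under transposition and under the entrywise product. -/
structure IsCoherentAlgebra {V : Type*} [Fintype V] (S : Subalgebra ℂ (Matrix V V ℂ)) : Prop where
  allOnes_mem : (Matrix.of fun _ _ => 1 : Matrix V V ℂ) ∈ S
  transpose_mem : ∀ M ∈ S, M.transpose ∈ S
  hadamard_mem : ∀ M ∈ S, ∀ N ∈ S, Matrix.hadamard M N ∈ S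

open Classical in
/-- The coherent closure of a graph: the smallest coherent algebra containing its adjacency
matrix. -/
def coherentClosure {V : Type*} [Fintype V] (G : SimpleGraph V) :
    Subalgebra ℂ (Matrix V V ℂ) :=
  sInf {S | IsCoherentAlgebra S ∧ G.adjMatrix ℂ ∈ S}

open Classical in
/-- The coherent closure is itself a coherent algebra. -/
theorem isCoherentAlgebra_coherentClosure {V : Type*} [Fintype V] (G : SimpleGraph V) :
    IsCoherentAlgebra (coherentClosure G) := by
  refine ⟨?_, ?_, ?_⟩
  · exact Algebra.mem_sInf.2 fun S hS => hS.1.allOnes_mem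
  · intro M hM
    exact Algebra.mem_sInf.2 fun S hS => hS.1.transpose_mem M (Algebra.mem_sInf.1 hM S hS)
  · intro M hM N hN
    exact Algebra.mem_sInf.2 fun S hS =>
      hS.1.hadamard_mem M (Algebra.mem_sInf.1 hM S hS) N (Algebra.mem_sInf.1 hN S hS)

open Classical in
/-- The coherent rank of a graph: the rank of its coherent closure, i.e. the number of elements of
the basis of `{0,1}`-matrices of the coherent closure, which is its dimension over `ℂ`. -/
def coherentRank {V : Type*} [Fintype V] (G : SimpleGraph V) : ℕ :=
  Module.finrank ℂ (coherentClosure G)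

/-! Quasi-symmetric designs. A family of blocks on the point set `P`, indexed by `B` (repeated
blocks are allowed), is a function `D : B → Finset P`. -/

open Classical in
/-- `D` is a quasi-symmetric 2-design with parameters `(v, k, l; b, r, {x, y})`. -/
structure IsQSD {P B : Type*} [Fintype P] [Fintype B] (D : B → Finset P)
    (v k l b r x y : ℕ) : Prop where
  card_points : Fintype.card P = v
  card_blocks : Fintype.card B = b
  one_le_k : 1 ≤ k
  card_block : ∀ j, (D j).card = k
  card_blocks_point : ∀ p, (Finset.univ.filter fun j => p ∈ D j).card = r
  card_blocks_pair : ∀ p q, p ≠ q → (Finset.univ.filter fun j => p ∈ D j ∧ q ∈ D j).card = l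
  x_ne_y : x ≠ y
  card_inter : ∀ i j, i ≠ j → (D i ∩ D j).card = x ∨ (D i ∩ D j).card = y
  x_occurs : ∃ i j, i ≠ j ∧ (D i ∩ D j).card = x
  y_occurs : ∃ i j, i ≠ j ∧ (D i ∩ D j).card = y

open Classical in
/-- The `x`-block graph: distinct blocks are adjacent when they meet in exactly `x` points. -/
def blockGraph {P B : Type*} (D : B → Finset P) (x : ℕ) : SimpleGraph B where
  Adj i j := i ≠ j ∧ (D i ∩ D j).card = x
  symm := ⟨fun i j h => ⟨h.1.symm, by rw [Finset.inter_comm]; exact h.2⟩⟩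
  loopless := ⟨fun i h => h.1 rfl⟩

/-- Adjacency in the `x`-total graph. -/
def totalAdj {P B : Type*} (D : B → Finset P) (x : ℕ) : P ⊕ B → P ⊕ B → Prop
  | .inl _, .inl _ => False
  | .inl p, .inr j => p ∈ D j
  | .inr j, .inl p => p ∈ D j
  | .inr i, .inr j => (blockGraph D x).Adj i j

/-- The `x`-total graph, on points and blocks: its adjacency matrix is `[O, M; Mᵀ, X]` where `M` is
the incidence matrix of `D` and `X` the adjacency matrix of the `x`-block graph. -/
def totalGraph {P B : Type*} (D : B → Finset P) (x : ℕ) : SimpleGraph (P ⊕ B) where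
  Adj := totalAdj D x
  symm := ⟨by
    rintro (p | i) (q | j) h
    · exact h
    · exact h
    · exact h
    · exact SimpleGraph.Adj.symm (G := blockGraph D x) h⟩
  loopless := ⟨by
    rintro (p | i) h
    · exact h
    · exact (blockGraph D x).irrefl h⟩

open Classical in
/-- The adjacency matrix of the total graph in block form. -/
theorem adjMatrix_totalGraph {P B : Type*} (D : B → Finset P) (x : ℕ) :
    (totalGraph D x).adjMatrix ℝ =
      Matrix.fromBlocks 0 (Matrix.of fun p j => if p ∈ D j then 1 else 0)
        (Matrix.of fun p j => if p ∈ D j then (1 : ℝ) else 0).transpose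
        ((blockGraph D x).adjMatrix ℝ) := by
  ext (p | i) (q | j) <;> rw [SimpleGraph.adjMatrix_apply] <;>
    simp [totalGraph, totalAdj, SimpleGraph.adjMatrix_apply] <;> congr

open Classical in
/-- `D`, with the choice `x` of one of its two intersection numbers, is the underlying
quasi-symmetric design of `G` with respect to the valency partition `{V₁, V₂}`: `G` has exactly two
degrees, with degree classes `V₁` and `V₂`; `G[V₁]` is empty or complete; and, after identifying
points with `V₁` and blocks with `V₂`, the adjacency between `V₁` and `V₂` is the incidence of
`D` and `G[V₂]` is the `x`-block graph of `D`. -/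
structure IsUnderlyingQSD {V P B : Type*} [Fintype V] (G : SimpleGraph V) (V₁ V₂ : Set V)
    (D : B → Finset P) (x : ℕ) : Prop where
  valency_partition : ∃ k₁ k₂ : ℕ, k₁ ≠ k₂ ∧ V₁ = {u | G.degree u = k₁} ∧
    V₂ = {u | G.degree u = k₂} ∧ V₁ ∪ V₂ = Set.univ
  empty_or_complete : G.induce V₁ = ⊥ ∨ G.induce V₁ = ⊤
  incidence : ∃ (f : P ≃ V₁) (g : B ≃ V₂),
    (∀ p j, G.Adj (f p) (g j) ↔ p ∈ D j) ∧
    (∀ i j, G.Adj (g i) (g j) ↔ (blockGraph D x).Adj i j)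

/-- The function `f₂`. -/
def f₂ (w z : ℝ) : ℝ :=
  (w * (w ^ 2 + w + 1) - 2 * z * (w + 1)
    + w * Real.sqrt ((w ^ 2 + w + 1) ^ 2 - 4 * w * z * (w + 1))) / 2

/-- The expressions for the parameters of the quasi-symmetric design. -/
structure ClassTwoTable (θ₀ θ₁ θ₂ e₀ : ℝ) (v k l b r x y : ℕ) : Prop where
  v_eq : (v : ℝ) = -θ₂ * (θ₀ - θ₁) / l
  k_eq : (k : ℝ) = y + θ₁ ^ 2
  l_eq : (l : ℝ) = -θ₂ * ((x : ℝ) - 1) / θ₁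
  b_eq : (b : ℝ) = r - k + e₀ + 1
  r_eq : (r : ℝ) = l - θ₁ * θ₂
  x_eq : (x : ℝ) = y - θ₁
  y_eq : (y : ℝ) = (e₀ - θ₁ ^ 3 + θ₁ * θ₂) / θ₁

end

noncomputable section

set_option linter.unusedSectionVars false

/-! ### Eigenvalues of graphs -/

/-! Let M be the incidence matrix and X the adjacency matrix of the block graph. The design axioms
say M Mᵀ = (r − l)I + lJ and MᵀM = (k − y)I + (x − y)X + yJ. As x ≠ y, these rewrite every product
of M, Mᵀ, X and J linearly. They also yield two quadratics whose roots are eigenvalues of the total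
graph: vectors constant on points and on blocks give μ² = dμ + rk, with d the degree of the block
graph; vectors built from a zero-sum q on the points give μ² = sμ + (r − l), with s the eigenvalue
of X on Mᵀq.

In the direct part Γ is isomorphic to the total graph, e₀ = d and e₂ = s. Each quadratic has exactly
one negative root, which must be θ₂ because θ₁ = e₁ ≥ 0; comparing the sums of roots identifies the
positive roots as θ₀ and θ₁. Vieta's formulas then express d, s, rk and r − l in the eigenvalues.
The double counts of design theory eliminate the other parameters (`classTwoTable_of_identities`)
and leave (k + θ₂)(k² − (θ₁² + θ₁ + 1)k + θ₁(θ₁ + 1)θ₂) = 0. A zero first factor would make Γ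
regular, so k is the positive root of the second; this is the source of the square root in f₂.

Conversely, (*) gives back the same identities (`ClassTwoTable.identities`). An eigenvector for any
value other than θ₁ and θ₂ is then constant on points and on blocks, so its eigenvalue solves the
first quadratic (`IsQSD.quotient_of_mem_graphEigenvalues`). For the coherent rank, the nine natural
classes of pairs span an algebra; when the two degrees differ, the diagonal of A² separates points
from blocks, and this forces all nine classes into the coherent closure. -/

open Classical in
theorem mem_graphEigenvalues_iff {V : Type*} [Fintype V] (G : SimpleGraph V) (μ : ℝ) :
    μ ∈ graphEigenvalues G ↔
      ∃ u : V → ℝ, u ≠ 0 ∧ (G.adjMatrix ℝ).mulVec u = μ • u := by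
  unfold graphEigenvalues
  rw [← Matrix.spectrum_toLin', ← Module.End.hasEigenvalue_iff_mem_spectrum]
  constructor
  · intro h
    obtain ⟨u, hu⟩ := h.exists_hasEigenvector
    exact ⟨u, hu.2, by simpa using hu.apply_eq_smul⟩
  · rintro ⟨u, hu, h⟩
    exact Module.End.hasEigenvalue_of_hasEigenvector
      (Module.End.hasEigenvector_iff.2 ⟨Module.End.mem_eigenspace_iff.2 (by simpa using h), hu⟩)

open Classical in
theorem graphEigenvalues_subset_of_iso {V W : Type*} [Fintype V] [Fintype W]
    {G : SimpleGraph V} {H : SimpleGraph W} (e : G ≃g H) :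
    graphEigenvalues G ⊆ graphEigenvalues H := by
  intro μ hμ
  rw [mem_graphEigenvalues_iff] at hμ ⊢
  obtain ⟨u, hu, h⟩ := hμ
  refine ⟨u ∘ e.symm, ?_, ?_⟩
  · rintro h0
    apply hu
    ext i
    simpa using congrFun h0 (e i)
  · ext i
    have := congrFun h (e.symm i)
    simp only [Matrix.mulVec, dotProduct, SimpleGraph.adjMatrix_apply, Pi.smul_apply,
      Function.comp] at this ⊢
    rw [← this]
    refine Fintype.sum_equiv e.symm.toEquiv _ _ fun j => ?_
    have h1 : G.Adj (e.symm i) (e.symm j) ↔ H.Adj i j := e.symm.map_adj_iff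
    simp [h1]

theorem graphEigenvalues_eq_of_iso {V W : Type*} [Fintype V] [Fintype W]
    {G : SimpleGraph V} {H : SimpleGraph W} (e : G ≃g H) :
    graphEigenvalues G = graphEigenvalues H :=
  (graphEigenvalues_subset_of_iso e).antisymm (graphEigenvalues_subset_of_iso e.symm)

open Classical in
/-- An eigenvalue of a graph with constant row sum `d` is at most `d`. -/
theorem le_of_mem_graphEigenvalues {V : Type*} [Fintype V] (G : SimpleGraph V) {d μ : ℝ}
    (hd : ∀ i, ∑ j, G.adjMatrix ℝ i j = d) (hμ : μ ∈ graphEigenvalues G) : μ ≤ d := by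
  rw [mem_graphEigenvalues_iff] at hμ
  obtain ⟨u, hu, h⟩ := hμ
  obtain ⟨i₀, hi₀⟩ := Function.ne_iff.1 hu
  -- Evaluate the eigenvector equation at a coordinate of largest absolute value.
  obtain ⟨i, -, hi⟩ := Finset.exists_max_image Finset.univ (fun i => |u i|) ⟨i₀, Finset.mem_univ _⟩
  have hpos : 0 < |u i| := (abs_pos.2 hi₀).trans_le (hi i₀ (Finset.mem_univ _))
  have h1 : μ * u i = ∑ j, G.adjMatrix ℝ i j * u j := (congrFun h i).symm
  have h2 : |μ * u i| ≤ d * |u i| := by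
    rw [h1, ← hd i, Finset.sum_mul]
    refine (Finset.abs_sum_le_sum_abs _ _).trans (Finset.sum_le_sum fun j _ => ?_)
    have h0 : 0 ≤ G.adjMatrix ℝ i j := by
      rw [SimpleGraph.adjMatrix_apply]; split_ifs <;> norm_num
    rw [abs_mul, abs_of_nonneg h0]
    exact mul_le_mul_of_nonneg_left (hi j (Finset.mem_univ _)) h0
  rw [abs_mul] at h2
  exact (le_abs_self μ).trans (le_of_mul_le_mul_right h2 hpos)

/-! ### Incidence matrices of quasi-symmetric designs -/

/-- The all-ones matrix. -/
def allOnes (K : Type*) [One K] (m n : Type*) : Matrix m n K := Matrix.of fun _ _ => 1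

@[simp] theorem allOnes_apply {K : Type*} [One K] {m n : Type*} (i : m) (j : n) :
    allOnes K m n i j = 1 := rfl

@[simp] theorem allOnes_transpose {K : Type*} [One K] {m n : Type*} :
    (allOnes K m n).transpose = allOnes K n m := rfl

theorem allOnes_mul_allOnes {K : Type*} [NonAssocSemiring K] {m n o : Type*} [Fintype n] :
    allOnes K m n * allOnes K n o = (Fintype.card n : K) • allOnes K m o := by
  ext i j
  simp [Matrix.mul_apply]

open Classical in
/-- The points-by-blocks incidence matrix. -/
def incidence (K : Type*) [Zero K] [One K] {P B : Type*} (D : B → Finset P) : Matrix P B K :=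
  Matrix.of fun p j => if p ∈ D j then 1 else 0

open Classical in
theorem incidence_apply {K : Type*} [Zero K] [One K] {P B : Type*} (D : B → Finset P) (p : P)
    (j : B) : incidence K D p j = if p ∈ D j then 1 else 0 := rfl

open Classical in
/-- The adjacency matrix of the block graph. -/
def blockMatrix (K : Type*) [Zero K] [One K] {P B : Type*} (D : B → Finset P) (x : ℕ) :
    Matrix B B K := (blockGraph D x).adjMatrix K

open Classical in
theorem blockMatrix_apply {K : Type*} [Zero K] [One K] {P B : Type*} (D : B → Finset P) (x : ℕ)
    (i j : B) : blockMatrix K D x i j = if i ≠ j ∧ (D i ∩ D j).card = x then 1 else 0 := by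
  rw [blockMatrix, SimpleGraph.adjMatrix_apply]
  exact if_congr Iff.rfl rfl rfl

theorem blockMatrix_transpose {K : Type*} [Zero K] [One K] {P B : Type*} (D : B → Finset P)
    (x : ℕ) : (blockMatrix K D x).transpose = blockMatrix K D x := by
  classical
  exact SimpleGraph.transpose_adjMatrix _

section Design

variable {K : Type*} [Field K] [CharZero K] {P B : Type*} [Fintype P] [Fintype B]
  {D : B → Finset P} {v k l b r x y : ℕ}

/-- The degree of the block graph. -/
def blockDegree (K : Type*) [Field K] (k b r x y : ℕ) : K :=
  ((r : K) * k - (k - y) - y * b) / (x - y)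

/-- The eigenvalue of the block graph on the image of the transposed incidence matrix. -/
def blockEigenvalue (K : Type*) [Field K] (k l r x y : ℕ) : K :=
  ((r : K) - l - k + y) / (x - y)

/-- The number of neighbours, in the block graph, of a block off a point that pass through it. -/
def crossNumber (K : Type*) [Field K] (k l r x y : ℕ) : K :=
  ((l : K) * k - y * r) / (x - y)

open Classical in
theorem IsQSD.incidence_mul_transpose (h : IsQSD D v k l b r x y) :
    incidence K D * (incidence K D).transpose =
      ((r : K) - l) • (1 : Matrix P P K) + (l : K) • allOnes K P P := by
  ext p q
  simp only [Matrix.mul_apply, incidence_apply, Matrix.transpose_apply, Matrix.add_apply,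
    Matrix.smul_apply, allOnes_apply, smul_eq_mul, mul_one, ← ite_and, mul_ite, mul_zero]
  rw [Finset.sum_boole]
  by_cases hpq : p = q
  · subst hpq
    rw [← h.card_blocks_point p]
    simp
  · rw [← h.card_blocks_pair p q hpq]
    simp [Matrix.one_apply_ne hpq, and_comm]

open Classical in
-- Entry (i, j) is the size of `D i ∩ D j`, which is k, x or y. Since x ≠ y, the identity can be
-- solved for the block matrix; that makes the block graph algebraically accessible.
theorem IsQSD.transpose_mul_incidence (h : IsQSD D v k l b r x y) :
    (incidence K D).transpose * incidence K D =
      ((k : K) - y) • (1 : Matrix B B K) + ((x : K) - y) • blockMatrix K D x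
        + (y : K) • allOnes K B B := by
  ext i j
  have hL : ((incidence K D).transpose * incidence K D) i j = ((D i ∩ D j).card : K) := by
    simp only [Matrix.mul_apply, incidence_apply, Matrix.transpose_apply, ← ite_and, mul_ite,
      mul_one, mul_zero]
    rw [Finset.sum_boole]
    congr 2
    ext p
    simp [and_comm]
  rw [hL]
  simp only [Matrix.add_apply, Matrix.smul_apply, allOnes_apply, smul_eq_mul, blockMatrix_apply]
  by_cases hij : i = j
  · subst hij
    simp [h.card_block]
  · rcases h.card_inter i j hij with hx | hy
    · simp [hij, hx, Matrix.one_apply_ne hij]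
    · simp [hij, hy, h.x_ne_y.symm, Matrix.one_apply_ne hij]

theorem IsQSD.incidence_mul_allOnes (h : IsQSD D v k l b r x y) (C : Type*) :
    incidence K D * allOnes K B C = (r : K) • allOnes K P C := by
  classical
  ext p q
  simp only [Matrix.mul_apply, incidence_apply, Matrix.smul_apply, allOnes_apply, smul_eq_mul,
    mul_one]
  rw [Finset.sum_boole, ← h.card_blocks_point p]

theorem IsQSD.transpose_mul_allOnes (h : IsQSD D v k l b r x y) (C : Type*) :
    (incidence K D).transpose * allOnes K P C = (k : K) • allOnes K B C := by
  classical
  ext j q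
  simp only [Matrix.mul_apply, incidence_apply, Matrix.smul_apply, allOnes_apply, smul_eq_mul,
    mul_one, Matrix.transpose_apply]
  rw [Finset.sum_boole, ← h.card_block j]
  simp

theorem IsQSD.allOnes_mul_incidence (h : IsQSD D v k l b r x y) (C : Type*) :
    allOnes K C P * incidence K D = (k : K) • allOnes K C B := by
  apply Matrix.transpose_injective
  simp [Matrix.transpose_mul, h.transpose_mul_allOnes]

theorem IsQSD.allOnes_mul_transpose (h : IsQSD D v k l b r x y) (C : Type*) :
    allOnes K C B * (incidence K D).transpose = (r : K) • allOnes K C P := by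
  apply Matrix.transpose_injective
  simp [Matrix.transpose_mul, h.incidence_mul_allOnes]

variable (K) in
theorem IsQSD.inter_sub_ne_zero (h : IsQSD D v k l b r x y) : (x : K) - y ≠ 0 :=
  sub_ne_zero.2 (Nat.cast_injective.ne h.x_ne_y)

open Classical in
theorem IsQSD.blockMatrix_eq (h : IsQSD D v k l b r x y) :
    blockMatrix K D x = ((x : K) - y)⁻¹ • ((incidence K D).transpose * incidence K D
      - ((k : K) - y) • (1 : Matrix B B K) - (y : K) • allOnes K B B) := by
  rw [h.transpose_mul_incidence, eq_inv_smul_iff₀ (h.inter_sub_ne_zero K)]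
  abel

theorem IsQSD.blockMatrix_mul_allOnes (h : IsQSD D v k l b r x y) (C : Type*) :
    blockMatrix K D x * allOnes K B C = blockDegree K k b r x y • allOnes K B C := by
  classical
  have hb := h.card_blocks
  rw [h.blockMatrix_eq, Matrix.smul_mul, Matrix.sub_mul, Matrix.sub_mul, Matrix.mul_assoc,
    h.incidence_mul_allOnes, Matrix.mul_smul, h.transpose_mul_allOnes, Matrix.smul_mul,
    Matrix.smul_mul, Matrix.one_mul, allOnes_mul_allOnes, hb]
  simp only [smul_smul, ← sub_smul]
  congr 1
  rw [blockDegree, div_eq_inv_mul]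

theorem IsQSD.allOnes_mul_blockMatrix (h : IsQSD D v k l b r x y) (C : Type*) :
    allOnes K C B * blockMatrix K D x = blockDegree K k b r x y • allOnes K C B := by
  apply Matrix.transpose_injective
  simp [Matrix.transpose_mul, blockMatrix_transpose, h.blockMatrix_mul_allOnes]

theorem IsQSD.incidence_mul_blockMatrix (h : IsQSD D v k l b r x y) :
    incidence K D * blockMatrix K D x = blockEigenvalue K k l r x y • incidence K D
      + crossNumber K k l r x y • allOnes K P B := by
  classical
  rw [h.blockMatrix_eq, Matrix.mul_smul, Matrix.mul_sub, Matrix.mul_sub, ← Matrix.mul_assoc,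
    h.incidence_mul_transpose, Matrix.add_mul, Matrix.mul_smul, Matrix.mul_smul, Matrix.smul_mul,
    Matrix.smul_mul, Matrix.one_mul, Matrix.mul_one, h.allOnes_mul_incidence,
    h.incidence_mul_allOnes, blockEigenvalue, crossNumber]
  ext p j
  simp only [Matrix.smul_apply, Matrix.sub_apply, Matrix.add_apply, allOnes_apply, smul_eq_mul]
  ring

theorem IsQSD.blockMatrix_mul_transpose (h : IsQSD D v k l b r x y) :
    blockMatrix K D x * (incidence K D).transpose =
      blockEigenvalue K k l r x y • (incidence K D).transpose
        + crossNumber K k l r x y • allOnes K B P := by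
  apply Matrix.transpose_injective
  simp [Matrix.transpose_mul, blockMatrix_transpose, h.incidence_mul_blockMatrix]

open Classical in
theorem IsQSD.blockMatrix_mul_self (h : IsQSD D v k l b r x y) :
    ((x : K) - y) • (blockMatrix K D x * blockMatrix K D x) =
      (blockEigenvalue K k l r x y * (k - y)) • (1 : Matrix B B K)
      + (blockEigenvalue K k l r x y * (x - y) - (k - y)) • blockMatrix K D x
      + (blockEigenvalue K k l r x y * y + crossNumber K k l r x y * k
          - y * blockDegree K k b r x y) • allOnes K B B := by
  have h1 : ((x : K) - y) • (blockMatrix K D x * blockMatrix K D x) =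
      blockMatrix K D x * ((incidence K D).transpose * incidence K D
      - ((k : K) - y) • (1 : Matrix B B K) - (y : K) • allOnes K B B) := by
    rw [h.transpose_mul_incidence, ← Matrix.mul_smul]
    congr 1
    abel
  rw [h1, Matrix.mul_sub, Matrix.mul_sub, ← Matrix.mul_assoc, h.blockMatrix_mul_transpose,
    Matrix.add_mul, Matrix.smul_mul, Matrix.smul_mul, h.transpose_mul_incidence,
    h.allOnes_mul_incidence, Matrix.mul_smul, Matrix.mul_smul, Matrix.mul_one,
    h.blockMatrix_mul_allOnes]
  ext i j
  simp only [Matrix.smul_apply, Matrix.sub_apply, Matrix.add_apply, allOnes_apply, smul_eq_mul]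
  ring

/-! ### Scalar identities -/

theorem IsQSD.nonempty_block (h : IsQSD D v k l b r x y) : Nonempty B := ⟨h.x_occurs.choose⟩

theorem IsQSD.nonempty_point (h : IsQSD D v k l b r x y) : Nonempty P := by
  obtain ⟨j⟩ := h.nonempty_block
  have : (D j).Nonempty := by
    rw [← Finset.card_pos, h.card_block]
    exact h.one_le_k
  exact ⟨this.choose⟩

/-- Evaluating M Mᵀ J in two ways: this is the relation r(k − 1) = l(v − 1). -/
theorem IsQSD.mul_replication (h : IsQSD D v k l b r x y) :
    (k : K) * r = r - l + l * v := by
  classical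
  obtain ⟨p⟩ := h.nonempty_point
  have h1 := congrArg (· * allOnes K P P) (h.incidence_mul_transpose (K := K))
  simp only [Matrix.mul_assoc, h.transpose_mul_allOnes, Matrix.mul_smul, h.incidence_mul_allOnes,
    Matrix.add_mul, Matrix.smul_mul, Matrix.one_mul, allOnes_mul_allOnes, h.card_points] at h1
  simpa using congrFun (congrFun h1 p) p

/-- Associativity of J M J counts the incidences by points and by blocks. -/
theorem IsQSD.blocks_mul (h : IsQSD D v k l b r x y) : (b : K) * k = v * r := by
  obtain ⟨p⟩ := h.nonempty_point
  have h1 : allOnes K P P * (incidence K D * allOnes K B P)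
      = allOnes K P P * incidence K D * allOnes K B P := (Matrix.mul_assoc _ _ _).symm
  rw [h.incidence_mul_allOnes, h.allOnes_mul_incidence, Matrix.smul_mul, Matrix.mul_smul,
    allOnes_mul_allOnes, allOnes_mul_allOnes, h.card_points, h.card_blocks] at h1
  have h2 := congrFun (congrFun h1 p) p
  simp only [Matrix.smul_apply, allOnes_apply, smul_eq_mul, mul_one] at h2
  linear_combination -h2

theorem IsQSD.blockDegree_mul (h : IsQSD D v k l b r x y) :
    blockDegree K k b r x y * (x - y) = r * k - (k - y) - y * b :=
  div_mul_cancel₀ _ (h.inter_sub_ne_zero K)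

theorem IsQSD.blockEigenvalue_mul (h : IsQSD D v k l b r x y) :
    blockEigenvalue K k l r x y * (x - y) = r - l - k + y :=
  div_mul_cancel₀ _ (h.inter_sub_ne_zero K)

theorem IsQSD.crossNumber_mul (h : IsQSD D v k l b r x y) :
    crossNumber K k l r x y * (x - y) = l * k - y * r :=
  div_mul_cancel₀ _ (h.inter_sub_ne_zero K)

/-- Counting pairs of points in which a given block meets the other blocks. -/
theorem IsQSD.mul_blockDegree (h : IsQSD D v k l b r x y) :
    (x : K) * blockDegree K k b r x y * (x - y) = k * (r - l - k + y + l * k - y * r) := by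
  classical
  obtain ⟨j⟩ := h.nonempty_block
  have h1 := congrFun (congrFun (h.blockMatrix_mul_self (K := K)) j) j
  have h2 := congrFun (congrFun (h.blockMatrix_mul_allOnes (K := K) B) j) j
  -- The block matrix is symmetric with entries 0 and 1, so the diagonal of its square lists the row
  -- sums.
  have h3 : (blockMatrix K D x * blockMatrix K D x) j j
      = (blockMatrix K D x * allOnes K B B) j j := by
    simp only [Matrix.mul_apply, allOnes_apply, mul_one]
    refine Finset.sum_congr rfl fun i _ => ?_
    rw [← blockMatrix_transpose, Matrix.transpose_apply, blockMatrix_transpose, blockMatrix_apply]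
    simp
  simp only [Matrix.smul_apply, Matrix.add_apply, allOnes_apply, smul_eq_mul, mul_one,
    Matrix.one_apply_eq, h3] at h1
  simp only [Matrix.smul_apply, allOnes_apply, smul_eq_mul, mul_one] at h2
  rw [h2] at h1
  simp only [blockMatrix_apply, ne_eq, not_true_eq_false, false_and, if_false, mul_zero,
    add_zero] at h1
  linear_combination (x - y : K) * h1 + k * h.blockEigenvalue_mul (K := K)
    + k * h.crossNumber_mul (K := K)

/-! ### Inequalities between the parameters -/

theorem IsQSD.le_block (h : IsQSD D v k l b r x y) : y ≤ k := by
  classical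
  obtain ⟨i, j, -, hy⟩ := h.y_occurs
  rw [← hy, ← h.card_block i]
  exact (Finset.card_le_card Finset.inter_subset_left).trans_eq (by congr)

/-- No block contains every point. -/
theorem IsQSD.exists_not_mem (h : IsQSD D v k l b r x y) (j : B) : ∃ p, p ∉ D j := by
  classical
  by_contra! hall
  -- All blocks have equal size, so one full block makes every block full, and then x = y.
  have hu : ∀ i, D i = Finset.univ := fun i => by
    rw [← Finset.card_eq_iff_eq_univ, h.card_block, ← h.card_block j,
      Finset.card_eq_iff_eq_univ, Finset.eq_univ_iff_forall]
    exact hall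
  obtain ⟨i, i', -, hx⟩ := h.x_occurs
  obtain ⟨m, m', -, hy⟩ := h.y_occurs
  apply h.x_ne_y
  rw [← hx, ← hy, hu, hu, hu, hu]

theorem IsQSD.exists_mem (h : IsQSD D v k l b r x y) (j : B) : ∃ p, p ∈ D j := by
  have : (D j).Nonempty := by
    rw [← Finset.card_pos, h.card_block]
    exact h.one_le_k
  exact this

theorem IsQSD.exists_ne_points (h : IsQSD D v k l b r x y) : ∃ p q : P, p ≠ q := by
  obtain ⟨j⟩ := h.nonempty_block
  obtain ⟨p, hp⟩ := h.exists_mem j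
  obtain ⟨q, hq⟩ := h.exists_not_mem j
  exact ⟨p, q, fun e => hq (e ▸ hp)⟩

/-- Some block contains one point and misses another. Strictness makes the constant term r − l of
the second quadratic nonzero. -/
theorem IsQSD.pair_lt_replication (h : IsQSD D v k l b r x y) : l < r := by
  classical
  obtain ⟨j⟩ := h.nonempty_block
  obtain ⟨p, hp⟩ := h.exists_mem j
  obtain ⟨q, hq⟩ := h.exists_not_mem j
  rw [← h.card_blocks_point p, ← h.card_blocks_pair p q (fun e => hq (e ▸ hp))]
  convert Finset.card_lt_card (Finset.ssubset_iff_subset_ne.2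
    ⟨Finset.monotone_filter_right Finset.univ (fun i _ (hi : p ∈ D i ∧ q ∈ D i) => hi.1), ?_⟩)
    using 2
  intro e
  have : j ∈ Finset.univ.filter fun i => p ∈ D i ∧ q ∈ D i := by
    rw [e]; simp [hp]
  simp [hq] at this

end Design

/-! ### Eigenvectors and eigenvalues of the block graph -/

section BlockSpectrum

variable {P B : Type*} [Fintype P] [Fintype B] {D : B → Finset P} {v k l b r x y : ℕ}

theorem allOnes_mulVec {m n : Type*} [Fintype n] (u : n → ℝ) :
    (allOnes ℝ m n).mulVec u = fun _ => ∑ j, u j := by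
  ext i
  simp [Matrix.mulVec, dotProduct]

theorem IsQSD.blockMatrix_mulVec_const (h : IsQSD D v k l b r x y) (a : ℝ) :
    (blockMatrix ℝ D x).mulVec (fun _ => a) = fun _ => blockDegree ℝ k b r x y * a := by
  ext i
  have := congrFun (congrFun (h.blockMatrix_mul_allOnes (K := ℝ) Unit) i) ()
  simp only [Matrix.mul_apply, Matrix.smul_apply, allOnes_apply, smul_eq_mul, mul_one] at this
  rw [← this, Finset.sum_mul]
  rfl

theorem IsQSD.incidence_mulVec_const (h : IsQSD D v k l b r x y) (a : ℝ) :
    (incidence ℝ D).mulVec (fun _ => a) = fun _ => r * a := by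
  ext i
  have := congrFun (congrFun (h.incidence_mul_allOnes (K := ℝ) Unit) i) ()
  simp only [Matrix.mul_apply, Matrix.smul_apply, allOnes_apply, smul_eq_mul, mul_one] at this
  rw [← this, Finset.sum_mul]
  rfl

theorem IsQSD.transpose_mulVec_const (h : IsQSD D v k l b r x y) (a : ℝ) :
    (incidence ℝ D).transpose.mulVec (fun _ => a) = fun _ => k * a := by
  ext i
  have := congrFun (congrFun (h.transpose_mul_allOnes (K := ℝ) Unit) i) ()
  simp only [Matrix.mul_apply, Matrix.smul_apply, allOnes_apply, smul_eq_mul, mul_one] at this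
  rw [← this, Finset.sum_mul]
  rfl

open Classical in
theorem mem_graphEigenvalues_blockGraph_iff {μ : ℝ} :
    μ ∈ graphEigenvalues (blockGraph D x) ↔
      ∃ u : B → ℝ, u ≠ 0 ∧ (blockMatrix ℝ D x).mulVec u = μ • u :=
  mem_graphEigenvalues_iff _ _

theorem IsQSD.le_blockDegree (h : IsQSD D v k l b r x y) {μ : ℝ}
    (hμ : μ ∈ graphEigenvalues (blockGraph D x)) : μ ≤ blockDegree ℝ k b r x y := by
  refine le_of_mem_graphEigenvalues _ (fun i => ?_) hμ
  have := congrFun (h.blockMatrix_mulVec_const 1) i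
  simp only [Matrix.mulVec, dotProduct, mul_one] at this
  exact this

theorem IsQSD.blockDegree_mem (h : IsQSD D v k l b r x y) :
    blockDegree ℝ k b r x y ∈ graphEigenvalues (blockGraph D x) := by
  obtain ⟨j⟩ := h.nonempty_block
  refine mem_graphEigenvalues_blockGraph_iff.2 ⟨fun _ => 1, fun h0 => ?_, ?_⟩
  · simpa using congrFun h0 j
  · rw [h.blockMatrix_mulVec_const]
    rfl

theorem IsQSD.exists_sum_eq_zero (h : IsQSD D v k l b r x y) :
    ∃ q : P → ℝ, q ≠ 0 ∧ ∑ p, q p = 0 := by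
  classical
  obtain ⟨p, p', hp⟩ := h.exists_ne_points
  refine ⟨Pi.single p 1 - Pi.single p' 1, fun h0 => ?_, by simp⟩
  simpa [hp] using congrFun h0 p

theorem IsQSD.incidence_mulVec_transpose_mulVec (h : IsQSD D v k l b r x y) {q : P → ℝ}
    (hq : ∑ p, q p = 0) :
    (incidence ℝ D).mulVec ((incidence ℝ D).transpose.mulVec q) = ((r : ℝ) - l) • q := by
  classical
  rw [Matrix.mulVec_mulVec, h.incidence_mul_transpose, Matrix.add_mulVec, Matrix.smul_mulVec,
    Matrix.smul_mulVec, allOnes_mulVec, hq, Matrix.one_mulVec]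
  ext
  simp

theorem IsQSD.blockMatrix_mulVec_transpose_mulVec (h : IsQSD D v k l b r x y) {q : P → ℝ}
    (hq : ∑ p, q p = 0) :
    (blockMatrix ℝ D x).mulVec ((incidence ℝ D).transpose.mulVec q)
      = blockEigenvalue ℝ k l r x y • (incidence ℝ D).transpose.mulVec q := by
  rw [Matrix.mulVec_mulVec, h.blockMatrix_mul_transpose, Matrix.add_mulVec, Matrix.smul_mulVec,
    Matrix.smul_mulVec, allOnes_mulVec, hq]
  ext
  simp

/-- The block graph of a quasi-symmetric design has at most three distinct eigenvalues. -/
theorem IsQSD.eq_of_mem_graphEigenvalues (h : IsQSD D v k l b r x y) {μ : ℝ}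
    (hμ : μ ∈ graphEigenvalues (blockGraph D x)) :
    μ = blockDegree ℝ k b r x y ∨ μ = blockEigenvalue ℝ k l r x y ∨
      μ * ((x : ℝ) - y) = y - k := by
  classical
  obtain ⟨u, hu, hX⟩ := mem_graphEigenvalues_blockGraph_iff.1 hμ
  by_cases hd : μ = blockDegree ℝ k b r x y
  · exact Or.inl hd
  right
  -- From JX = dJ: an eigenvector for another eigenvalue has zero sum.
  have hsum : ∑ j, u j = 0 := by
    have h1 := congrArg (fun M => M.mulVec u) (h.allOnes_mul_blockMatrix (K := ℝ) Unit)
    have h2 := congrFun h1 ()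
    simp only [← Matrix.mulVec_mulVec, hX, Matrix.smul_mulVec, Matrix.mulVec_smul, allOnes_mulVec,
      Pi.smul_apply, smul_eq_mul] at h2
    have h3 : (μ - blockDegree ℝ k b r x y) * ∑ j, u j = 0 := by linear_combination h2
    exact (mul_eq_zero.1 h3).resolve_left (sub_ne_zero.2 hd)
  by_cases hs : μ = blockEigenvalue ℝ k l r x y
  · exact Or.inl hs
  right
  -- On zero-sum vectors MX acts as sM, so Mu vanishes unless μ = s. With Mu = 0 and Ju = 0, the
  -- formula for MᵀM leaves k − y + (x − y)μ = 0.
  have hM : (incidence ℝ D).mulVec u = 0 := by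
    have h1 := congrArg (fun M => M.mulVec u) (h.incidence_mul_blockMatrix (K := ℝ))
    simp only [← Matrix.mulVec_mulVec, hX, Matrix.add_mulVec, Matrix.smul_mulVec,
      Matrix.mulVec_smul, allOnes_mulVec, hsum] at h1
    ext p
    have h2 := congrFun h1 p
    simp only [Pi.smul_apply, Pi.add_apply, smul_eq_mul, mul_zero, add_zero] at h2
    have h3 : (μ - blockEigenvalue ℝ k l r x y) * (incidence ℝ D).mulVec u p = 0 := by
      linear_combination h2
    exact (mul_eq_zero.1 h3).resolve_left (sub_ne_zero.2 hs)
  have h1 := congrArg (fun M => M.mulVec u) (h.transpose_mul_incidence (K := ℝ))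
  simp only [← Matrix.mulVec_mulVec, hM, Matrix.mulVec_zero, Matrix.add_mulVec,
    Matrix.smul_mulVec, Matrix.one_mulVec, hX, allOnes_mulVec, hsum] at h1
  obtain ⟨j, hj⟩ := Function.ne_iff.1 hu
  have h2 := congrFun h1 j
  simp only [Pi.smul_apply, Pi.add_apply, smul_eq_mul, mul_zero, add_zero, Pi.zero_apply] at h2
  have h3 : ((k : ℝ) - y + (x - y) * μ) * u j = 0 := by linear_combination -h2
  linear_combination (mul_eq_zero.1 h3).resolve_right hj

end BlockSpectrum

/-! ### The total graph -/

section Total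

variable {P B : Type*} [Fintype P] [Fintype B] {D : B → Finset P} {v k l b r x y : ℕ}

open Classical in
theorem totalGraph_adjMatrix_eq_fromBlocks (K : Type*) [Zero K] [One K] (D : B → Finset P)
    (x : ℕ) :
    (totalGraph D x).adjMatrix K =
      Matrix.fromBlocks 0 (incidence K D) (incidence K D).transpose (blockMatrix K D x) := by
  ext (p | i) (q | j) <;> rw [SimpleGraph.adjMatrix_apply] <;>
    simp [totalGraph, totalAdj, blockMatrix, incidence_apply, SimpleGraph.adjMatrix_apply] <;>
    congr

theorem mem_graphEigenvalues_totalGraph_iff {μ : ℝ} :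
    μ ∈ graphEigenvalues (totalGraph D x) ↔
      ∃ (a : P → ℝ) (c : B → ℝ), (a ≠ 0 ∨ c ≠ 0) ∧ (incidence ℝ D).mulVec c = μ • a ∧
        (incidence ℝ D).transpose.mulVec a + (blockMatrix ℝ D x).mulVec c = μ • c := by
  classical
  rw [mem_graphEigenvalues_iff, totalGraph_adjMatrix_eq_fromBlocks]
  constructor
  · rintro ⟨u, hu, h⟩
    rw [Matrix.fromBlocks_mulVec] at h
    refine ⟨u ∘ Sum.inl, u ∘ Sum.inr, ?_, ?_, ?_⟩
    · by_contra! h0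
      apply hu
      ext (p | j)
      · exact congrFun h0.1 p
      · exact congrFun h0.2 j
    · ext p
      simpa using congrFun h (Sum.inl p)
    · ext j
      simpa using congrFun h (Sum.inr j)
  · rintro ⟨a, c, h0, h1, h2⟩
    refine ⟨Sum.elim a c, fun h => ?_, ?_⟩
    · rcases h0 with h0 | h0
      · exact h0 (funext fun p => congrFun h (Sum.inl p))
      · exact h0 (funext fun j => congrFun h (Sum.inr j))
    · rw [Matrix.fromBlocks_mulVec]
      simp only [Sum.elim_comp_inl, Sum.elim_comp_inr, h1, h2, Matrix.zero_mulVec, zero_add]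
      ext (p | j) <;> simp

/-- The eigenvector is r on the points and μ on the blocks. -/
theorem IsQSD.mem_graphEigenvalues_totalGraph_of_degree (h : IsQSD D v k l b r x y) {μ : ℝ}
    (hμ : μ ^ 2 = blockDegree ℝ k b r x y * μ + r * k) :
    μ ∈ graphEigenvalues (totalGraph D x) := by
  obtain ⟨p⟩ := h.nonempty_point
  have hr : (0 : ℝ) < r := Nat.cast_pos.2 (Nat.zero_lt_of_lt h.pair_lt_replication)
  refine mem_graphEigenvalues_totalGraph_iff.2
    ⟨fun _ => r, fun _ => μ, Or.inl fun h0 => hr.ne' (congrFun h0 p), ?_, ?_⟩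
  · rw [h.incidence_mulVec_const]
    ext
    simp [mul_comm]
  · rw [h.transpose_mulVec_const, h.blockMatrix_mulVec_const]
    ext
    simp only [Pi.add_apply, Pi.smul_apply, smul_eq_mul]
    linear_combination -hμ

/-- For zero-sum q, the eigenvector is (r − l)q on the points and μMᵀq on the blocks; M Mᵀ
multiplies q by r − l. -/
theorem IsQSD.mem_graphEigenvalues_totalGraph_of_eigenvalue (h : IsQSD D v k l b r x y) {μ : ℝ}
    (hμ : μ ^ 2 = blockEigenvalue ℝ k l r x y * μ + (r - l)) :
    μ ∈ graphEigenvalues (totalGraph D x) := by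
  obtain ⟨q, hq0, hq⟩ := h.exists_sum_eq_zero
  have hr : (0 : ℝ) < r - l := sub_pos.2 (Nat.cast_lt.2 h.pair_lt_replication)
  refine mem_graphEigenvalues_totalGraph_iff.2
    ⟨((r : ℝ) - l) • q, μ • (incidence ℝ D).transpose.mulVec q,
      Or.inl (smul_ne_zero hr.ne' hq0), ?_, ?_⟩
  · rw [Matrix.mulVec_smul, h.incidence_mulVec_transpose_mulVec hq]
  · rw [Matrix.mulVec_smul, Matrix.mulVec_smul, h.blockMatrix_mulVec_transpose_mulVec hq]
    ext j
    simp only [Pi.add_apply, Pi.smul_apply, smul_eq_mul]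
    linear_combination -(incidence ℝ D).transpose.mulVec q j * hμ

/-- Under the numerical conditions of the three-eigenvalue case, every other eigenvalue of the
total graph is an eigenvalue of the quotient matrix on points and blocks. -/
theorem IsQSD.quotient_of_mem_graphEigenvalues (h : IsQSD D v k l b r x y) {w z μ : ℝ}
    (hxy : (x : ℝ) - y = -w) (hky : (k : ℝ) - y = w ^ 2) (hrl : (r : ℝ) - l = -(w * z))
    (hw : w ≠ 0) (hμw : μ ≠ w) (hμz : μ ≠ z) (hμ : μ ∈ graphEigenvalues (totalGraph D x)) :
    μ ^ 2 = blockDegree ℝ k b r x y * μ + r * k := by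
  classical
  obtain ⟨p⟩ := h.nonempty_point
  obtain ⟨j⟩ := h.nonempty_block
  obtain ⟨a, c, h0, h1, h2⟩ := mem_graphEigenvalues_totalGraph_iff.1 hμ
  have hs : blockEigenvalue ℝ k l r x y = w + z := by
    have := h.blockEigenvalue_mul (K := ℝ)
    rw [hxy] at this
    apply mul_left_cancel₀ (neg_ne_zero.2 hw)
    linear_combination this + hrl - hky
  have hne : (μ - w) * (μ - z) ≠ 0 := mul_ne_zero (sub_ne_zero.2 hμw) (sub_ne_zero.2 hμz)
  -- Apply M to the second eigenvector equation. Up to constant vectors it becomes (μ² − sμ − (r −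
  -- l))a = 0, and the coefficient is (μ − w)(μ − z).
  have ha : ∀ p', a p' = a p := by
    have h3 := congrArg (fun M => M.mulVec a) (h.incidence_mul_transpose (K := ℝ))
    have h4 := congrArg (fun M => M.mulVec c) (h.incidence_mul_blockMatrix (K := ℝ))
    simp only [← Matrix.mulVec_mulVec, Matrix.add_mulVec, Matrix.smul_mulVec, Matrix.one_mulVec,
      allOnes_mulVec, h1] at h3 h4
    have h5 := congrArg (incidence ℝ D).mulVec h2
    rw [Matrix.mulVec_add, Matrix.mulVec_smul, h1, h3, h4, hs, hrl] at h5
    intro p'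
    have h6 := congrFun h5 p'
    have h7 := congrFun h5 p
    simp only [Pi.smul_apply, Pi.add_apply, smul_eq_mul] at h6 h7
    apply mul_left_cancel₀ hne
    linear_combination h7 - h6
  -- Apply X to the second equation and compare with MᵀMc = μMᵀa. Eliminating Mᵀa and Xc leaves a
  -- nonzero multiple of (μ − w)(μ − z)c, up to constant vectors.
  have hc : ∀ j', c j' = c j := by
    have h3 := congrArg (fun M => M.mulVec c) (h.transpose_mul_incidence (K := ℝ))
    have h4 := congrArg (fun M => M.mulVec a) (h.blockMatrix_mul_transpose (K := ℝ))
    have h5 := congrArg (fun M => M.mulVec c) (h.blockMatrix_mul_self (K := ℝ))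
    simp only [← Matrix.mulVec_mulVec, Matrix.add_mulVec, Matrix.smul_mulVec, Matrix.one_mulVec,
      allOnes_mulVec, h1, hs, hxy, hky] at h3 h4 h5
    have h6 := congrArg (blockMatrix ℝ D x).mulVec h2
    rw [Matrix.mulVec_add, Matrix.mulVec_smul, h4] at h6
    intro j'
    have e2 := congrFun h2 j'
    have e3 := congrFun h3 j'
    have e5 := congrFun h5 j'
    have e6 := congrFun h6 j'
    have f2 := congrFun h2 j
    have f3 := congrFun h3 j
    have f5 := congrFun h5 j
    have f6 := congrFun h6 j
    simp only [Matrix.mulVec_smul, Pi.smul_apply, Pi.add_apply, smul_eq_mul] at e2 e3 e5 e6 f2 f3 f5 f6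
    apply mul_left_cancel₀ hne
    apply mul_left_cancel₀ hw
    linear_combination -(w * e6 + e5 - w * (w + z) * e2 + w * μ * e2 - w * e3)
      + (w * f6 + f5 - w * (w + z) * f2 + w * μ * f2 - w * f3)
  have hcc : c = fun _ => c j := funext hc
  have haa : a = fun _ => a p := funext ha
  have e1 := congrFun h1 p
  have e2 := congrFun h2 j
  rw [hcc, h.incidence_mulVec_const] at e1
  rw [hcc, haa, Pi.add_apply, h.transpose_mulVec_const, h.blockMatrix_mulVec_const] at e2
  simp only [Pi.smul_apply, smul_eq_mul] at e1 e2
  -- The constants satisfy r·c = μ·a and k·a + d·c = μ·c. If c = 0 then a = 0 as well, which is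
  -- impossible; otherwise c cancels after eliminating a.
  by_cases hc0 : c j = 0
  · exfalso
    have hk : (k : ℝ) ≠ 0 := Nat.cast_ne_zero.2 (Nat.one_le_iff_ne_zero.1 h.one_le_k)
    rw [hc0, mul_zero, mul_zero, add_zero] at e2
    have ha0 := (mul_eq_zero.1 e2).resolve_left hk
    rw [hc0] at hcc
    rw [ha0] at haa
    exact h0.elim (fun h => h haa) (fun h => h hcc)
  · apply mul_right_cancel₀ hc0
    linear_combination -μ * e2 - k * e1

end Total

/-! ### Arithmetic of the parameters -/

section Arithmetic

variable {w z : ℝ}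

/-- The larger root of `k² - (w² + w + 1) k + w (w + 1) z`, the block size in terms of the
eigenvalues. -/
def blockSizeRoot (w z : ℝ) : ℝ :=
  ((w ^ 2 + w + 1) + Real.sqrt ((w ^ 2 + w + 1) ^ 2 - 4 * w * z * (w + 1))) / 2

theorem f₂_eq (w z : ℝ) : f₂ w z = w * blockSizeRoot w z - z * (w + 1) := by
  rw [f₂, blockSizeRoot]
  ring

theorem blockSizeRoot_sq (hw : 0 < w) (hz : z < 0) :
    blockSizeRoot w z ^ 2 - (w ^ 2 + w + 1) * blockSizeRoot w z + w * (w + 1) * z = 0 := by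
  have h0 : 0 ≤ (w ^ 2 + w + 1) ^ 2 - 4 * w * z * (w + 1) := by
    have : 0 < w * -z * (w + 1) := by have := neg_pos.2 hz; positivity
    nlinarith [sq_nonneg (w ^ 2 + w + 1)]
  have h1 := Real.sq_sqrt h0
  rw [blockSizeRoot]
  linear_combination h1 / 4

/-- The constant term is negative, so the roots have opposite signs and positivity singles out the
larger one. -/
theorem eq_blockSizeRoot {k : ℝ} (hw : 0 < w) (hz : z < 0) (hk : 0 < k)
    (hQ : k ^ 2 - (w ^ 2 + w + 1) * k + w * (w + 1) * z = 0) : k = blockSizeRoot w z := by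
  have h1 : 0 < k * (k - (w ^ 2 + w + 1)) := by
    have : 0 < w * (w + 1) * -z := by have := neg_pos.2 hz; positivity
    linarith
  have h2 : 0 < k - (w ^ 2 + w + 1) := pos_of_mul_pos_right h1 hk.le
  have h3 : Real.sqrt ((w ^ 2 + w + 1) ^ 2 - 4 * w * z * (w + 1)) = 2 * k - (w ^ 2 + w + 1) := by
    rw [show (w ^ 2 + w + 1) ^ 2 - 4 * w * z * (w + 1) = (2 * k - (w ^ 2 + w + 1)) ^ 2 by
      linear_combination -4 * hQ]
    exact Real.sqrt_sq (by linarith)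
  rw [blockSizeRoot, h3]
  ring

/-- A monic quadratic with negative constant term has a positive and a negative root. -/
theorem exists_roots_of_pos (p : ℝ) {c : ℝ} (hc : 0 < c) :
    ∃ s t : ℝ, t < 0 ∧ 0 < s ∧ s + t = p ∧ s * t = -c ∧
      s ^ 2 = p * s + c ∧ t ^ 2 = p * t + c := by
  have h0 : 0 ≤ p ^ 2 + 4 * c := by positivity
  have h1 := Real.sq_sqrt h0
  have h2 : |p| < Real.sqrt (p ^ 2 + 4 * c) := by
    rw [← Real.sqrt_sq_eq_abs]
    exact Real.sqrt_lt_sqrt (sq_nonneg p) (by linarith)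
  obtain ⟨h3, h4⟩ := abs_lt.1 h2
  refine ⟨(p + Real.sqrt (p ^ 2 + 4 * c)) / 2, (p - Real.sqrt (p ^ 2 + 4 * c)) / 2,
    by linarith, by linarith, by ring, ?_, ?_, ?_⟩
  · linear_combination -h1 / 4
  · linear_combination h1 / 4
  · linear_combination h1 / 4

/-- The number of blocks as a function of the other parameters. -/
theorem mul_blockCount {k r : ℝ} (hk : k ≠ 0)
    (hQ : k ^ 2 - (w ^ 2 + w + 1) * k + w * (w + 1) * z = 0)
    (hrk : r * k = -((w * k - z * (w + 1)) * z)) :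
    (k - w ^ 2) * (r - k + ((w * k - z * (w + 1)) + z) + 1)
      = ((w * k - z * (w + 1)) - w) * (w - z) := by
  apply mul_left_cancel₀ hk
  linear_combination (k - w ^ 2) * hrk + ((w - 1) * k - w * z) * hQ

/-- Pure elimination, with t, w, z, d in the roles of θ₀, θ₁, θ₂, e₀: the four counting relations
and Vieta's formulas determine t and all parameters once the regular case is excluded. -/
theorem classTwoTable_of_identities {t d : ℝ} {v k l b r x y : ℕ}
    (hw : 0 < w) (hz : z < 0) (ht : w < t) (hk : 1 ≤ k)
    (F1 : (b : ℝ) * k = v * r) (F2 : (k : ℝ) * r = r - l + l * v)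
    (F3 : d * ((x : ℝ) - y) = r * k - (k - y) - y * b)
    (F4 : (x : ℝ) * d * (x - y) = k * (r - l - k + y + l * k - y * r))
    (hd : d = t + z) (hrk : (r : ℝ) * k = -(t * z)) (hrl : (r : ℝ) - l = -(w * z))
    (hx : (x : ℝ) - y = -w) (hy : (k : ℝ) - y = w ^ 2) (hreg : (r : ℝ) ≠ k + d) :
    t = f₂ w z ∧ ClassTwoTable t w z d v k l b r x y := by
  have hk0 : (0 : ℝ) < k := Nat.cast_pos.2 hk
  have hvl : (l : ℝ) * v = -(z * (t - w)) := by linear_combination -F2 + hrk - hrl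
  have hyb : (y : ℝ) * b = (t - w) * (w - z) := by
    linear_combination F3 + hrk - hy - d * hx + w * hd
  have hlk : (l : ℝ) * k = -(t * z) + w * z * k := by linear_combination hrk - k * hrl
  have hy' : (y : ℝ) = k - w ^ 2 := by linear_combination -hy
  have hx' : (x : ℝ) = k - w ^ 2 - w := by linear_combination hx - hy
  have hpos : 0 < (k : ℝ) - w * z := by have := mul_pos hw (neg_pos.2 hz); linarith
  -- Eliminates b and v: the product l·k·y·b is computed from `hyb`, and from bk = vr together with
  -- `hvl`; the common factor t − w cancels.
  have E0 : (k - w ^ 2) * r * -z = k * l * (w - z) := by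
    apply mul_left_cancel₀ (sub_pos.2 ht).ne'
    rw [← hy']
    linear_combination (l * k : ℝ) * hyb - (y * l : ℝ) * F1 - (y * r : ℝ) * hvl
  have E1 : t * (k - w * z) = k ^ 2 * (w - z) := by
    apply mul_left_cancel₀ (mul_ne_zero hw.ne' hz.ne)
    linear_combination (k : ℝ) * E0 + (k - w ^ 2) * z * hrk + k * (w - z) * hlk
  have E2 : t * (k - w ^ 2 - w - z * w) = k * w + z * w * (w + 1) - z * k ^ 2 := by
    apply mul_left_cancel₀ hw.ne'
    rw [hx', hy', hd] at F4
    linear_combination -F4 - k * hrl - k * hlk + (k - w ^ 2) * hrk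
  -- `E1` and `E2` are both linear in t; this is their resultant, divided by w.
  have E3 : (k + z) * ((k : ℝ) ^ 2 - (w ^ 2 + w + 1) * k + w * (w + 1) * z) = 0 := by
    apply mul_left_cancel₀ hw.ne'
    linear_combination (k - w * z) * E2 - (k - w ^ 2 - w - z * w) * E1
  -- If k = −z, then rk = −tz gives r = t = k + d: the points and the blocks have the same degree.
  have hkz : (k : ℝ) + z ≠ 0 := by
    intro h0
    apply hreg
    apply mul_right_cancel₀ hk0.ne'
    rw [hrk, hd]
    linear_combination (-t - k) * h0
  have hQ := (mul_eq_zero.1 E3).resolve_left hkz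
  have hT : t = w * k - z * (w + 1) := by
    apply mul_right_cancel₀ hpos.ne'
    linear_combination E1 - z * hQ
  have hlk' : (l : ℝ) * k = z ^ 2 * (w + 1) := by rw [hlk, hT]; ring
  have hl0 : (l : ℝ) ≠ 0 := by
    intro h0
    rw [h0, zero_mul] at hlk'
    have : 0 < z ^ 2 * (w + 1) := by have := sq_pos_of_neg hz; positivity
    linarith
  -- The quadratic gives k(k − (w² + w + 1)) = −w(w + 1)z > 0. Hence y is nonzero and b can be read
  -- off from y·b.
  have hS : 0 < (k : ℝ) - w ^ 2 := by
    have h1 : 0 < (k : ℝ) * (k - (w ^ 2 + w + 1)) := by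
      have : 0 < w * (w + 1) * -z := by have := neg_pos.2 hz; positivity
      linarith
    have h2 := pos_of_mul_pos_right h1 hk0.le
    linarith
  refine ⟨?_, ?_, ?_, ?_, ?_, ?_, ?_, ?_⟩
  · rw [f₂_eq, ← eq_blockSizeRoot hw hz hk0 hQ, hT]
  · rw [eq_div_iff hl0]
    linear_combination hvl
  · linear_combination hy
  · rw [eq_div_iff hw.ne']
    apply mul_right_cancel₀ hk0.ne'
    rw [hx']
    linear_combination w * hlk' + z * hQ
  · apply mul_left_cancel₀ hS.ne'
    have := mul_blockCount hk0.ne' hQ (hT ▸ hrk)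
    rw [← hT] at this
    rw [hd, this, ← hy', hyb]
  · linear_combination hrl
  · linear_combination hx
  · rw [eq_div_iff hw.ne', hy', hd, hT]
    ring

/-- The table contains Vieta's formulas for the two quadratics, but the block degree d only
implicitly: it is recovered from b by counting the intersections of a block with the others. -/
theorem ClassTwoTable.identities {d : ℝ} {v k l b r x y : ℕ}
    (h : ClassTwoTable (f₂ w z) w z (f₂ w z + z) v k l b r x y)
    (hw : 0 < w) (hz : z < 0) (hk : 1 ≤ k)
    (F3 : d * ((x : ℝ) - y) = r * k - (k - y) - y * b) :
    d = f₂ w z + z ∧ (r : ℝ) * k = -(f₂ w z * z) ∧ (r : ℝ) - l = -(w * z) ∧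
      (x : ℝ) - y = -w ∧ (k : ℝ) - y = w ^ 2 ∧ w < f₂ w z ∧ (l : ℝ) * k = z ^ 2 * (w + 1) := by
  have hk0 : (0 : ℝ) < k := Nat.cast_pos.2 hk
  have hf := f₂_eq w z
  have hy : (y : ℝ) * w = f₂ w z + z - w ^ 3 + w * z := by
    rw [← eq_div_iff hw.ne']; exact h.y_eq
  -- The entries for k and y combine to wk = f₂ + z(w + 1).
  have hkr : (k : ℝ) = blockSizeRoot w z := by
    apply mul_left_cancel₀ hw.ne'
    linear_combination w * h.k_eq + hy + hf
  have hQ := blockSizeRoot_sq hw hz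
  rw [← hkr] at hf hQ
  have hl : (l : ℝ) * w = -z * (x - 1) := by
    rw [← eq_div_iff hw.ne']; exact h.l_eq
  have hlk : (l : ℝ) * k = z ^ 2 * (w + 1) := by
    apply mul_left_cancel₀ hw.ne'
    linear_combination k * hl - k * z * h.x_eq + k * z * h.k_eq - z * hQ
  have hrk : (r : ℝ) * k = -(f₂ w z * z) := by
    rw [hf]
    linear_combination k * h.r_eq + hlk
  refine ⟨?_, hrk, ?_, ?_, ?_, ?_, hlk⟩
  · apply mul_left_cancel₀ (neg_ne_zero.2 hw.ne')
    have h1 := mul_blockCount hk0.ne' hQ (hf ▸ hrk)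
    rw [← hf] at h1
    have hy' : (y : ℝ) = k - w ^ 2 := by linear_combination -h.k_eq
    have hx' : (x : ℝ) - y = -w := by linear_combination h.x_eq
    rw [hx', hy', h.b_eq] at F3
    linear_combination F3 + hrk - h1
  · linear_combination h.r_eq
  · linear_combination h.x_eq
  · linear_combination h.k_eq
  · rw [hf]
    have h1 : (1 : ℝ) ≤ k := Nat.one_le_cast.2 hk
    have h2 : w * 1 ≤ w * k := mul_le_mul_of_nonneg_left h1 hw.le
    have h3 : 0 < -z * (w + 1) := mul_pos (neg_pos.2 hz) (by linarith)
    linarith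

end Arithmetic

/-! ### Degrees of the total graph -/

section Degrees

variable {P B : Type*} [Fintype P] [Fintype B] {D : B → Finset P} {v k l b r x y : ℕ}

open Classical in
theorem IsQSD.degree_inl (h : IsQSD D v k l b r x y) (p : P) :
    (((totalGraph D x).degree (Sum.inl p) : ℕ) : ℝ) = r := by
  have h1 := SimpleGraph.adjMatrix_mulVec_const_apply (α := ℝ) (G := totalGraph D x) (a := 1)
    (v := Sum.inl p)
  rw [totalGraph_adjMatrix_eq_fromBlocks, Matrix.fromBlocks_mulVec, mul_one] at h1
  have h2 := congrFun (h.incidence_mulVec_const 1) p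
  rw [mul_one] at h2
  rw [← h1, ← h2, Matrix.zero_mulVec, zero_add]
  rfl

open Classical in
theorem IsQSD.degree_inr (h : IsQSD D v k l b r x y) (j : B) :
    (((totalGraph D x).degree (Sum.inr j) : ℕ) : ℝ) = k + blockDegree ℝ k b r x y := by
  have h1 := SimpleGraph.adjMatrix_mulVec_const_apply (α := ℝ) (G := totalGraph D x) (a := 1)
    (v := Sum.inr j)
  rw [totalGraph_adjMatrix_eq_fromBlocks, Matrix.fromBlocks_mulVec, mul_one] at h1
  rw [← h1]
  have h2 := congrFun (h.transpose_mulVec_const 1) j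
  have h3 := congrFun (h.blockMatrix_mulVec_const 1) j
  rw [mul_one] at h2 h3
  rw [← h2, ← h3]
  rfl

end Degrees

/-! ### Passing between the spectrum and the parameters -/

theorem IsUnderlyingQSD.nonempty_iso {V P B : Type*} [Fintype V] {G : SimpleGraph V}
    {V₁ V₂ : Set V} {D : B → Finset P} {x : ℕ} (h : IsUnderlyingQSD G V₁ V₂ D x)
    (h0 : G.induce V₁ = ⊥) :
    ∃ e : totalGraph D x ≃g G, (∀ p, e (Sum.inl p) ∈ V₁) ∧ ∀ j, e (Sum.inr j) ∈ V₂ := by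
  obtain ⟨f, g, hfg, hg⟩ := h.incidence
  obtain ⟨k₁, k₂, hk, h1, h2, hu⟩ := h.valency_partition
  -- The degree classes are disjoint, so gluing the two identifications gives an injective map.
  have hd : ∀ u, u ∈ V₁ → u ∈ V₂ → False := fun u hu1 hu2 => by
    rw [h1] at hu1
    rw [h2] at hu2
    exact hk (hu1.symm.trans hu2)
  let φ : P ⊕ B → V := Sum.elim (fun p => (f p : V)) fun j => (g j : V)
  have hφ : Function.Bijective φ := by
    constructor
    · rintro (p | i) (q | j) e
      · exact congrArg Sum.inl (f.injective (Subtype.ext e))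
      · exact (hd _ (f p).2 (by rw [show ((f p : V)) = g j from e]; exact (g j).2)).elim
      · exact (hd _ (f q).2 (by rw [show ((f q : V)) = g i from e.symm]; exact (g i).2)).elim
      · exact congrArg Sum.inr (g.injective (Subtype.ext e))
    · intro u
      rcases (hu ▸ Set.mem_univ u : u ∈ V₁ ∪ V₂) with hu1 | hu2
      · exact ⟨Sum.inl (f.symm ⟨u, hu1⟩), by simp [φ]⟩
      · exact ⟨Sum.inr (g.symm ⟨u, hu2⟩), by simp [φ]⟩
  refine ⟨⟨Equiv.ofBijective φ hφ, ?_⟩, fun p => (f p).2, fun j => (g j).2⟩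
  rintro (p | i) (q | j)
  · have h3 : ¬ (G.induce V₁).Adj (f p) (f q) := by rw [h0]; exact id
    exact iff_of_false h3 id
  · exact hfg p j
  · exact (G.adj_comm _ _).trans (hfg q i)
  · exact hg i j

theorem three_eigenvalue_parameters {V P B : Type*} [Fintype V] [Fintype P] [Fintype B]
    {G : SimpleGraph V} {θ₀ θ₁ θ₂ : ℝ} {V₁ V₂ : Set V} {D : B → Finset P}
    {v k l b r x y : ℕ} {e₀ e₁ e₂ : ℝ} (hG : InG3 G θ₀ θ₁ θ₂) (h : IsQSD D v k l b r x y)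
    (hU : IsUnderlyingQSD G V₁ V₂ D x) (h01 : e₀ > e₁) (h12 : e₁ > e₂)
    (hE : graphEigenvalues (blockGraph D x) = {e₀, e₁, e₂}) (hV₁ : G.induce V₁ = ⊥)
    (hθ : θ₁ = e₁) (he : e₁ = ((y : ℝ) - k) / ((x : ℝ) - y)) :
    θ₀ = f₂ θ₁ θ₂ ∧ e₀ = θ₀ + θ₂ ∧ e₂ = θ₁ + θ₂ ∧
      ClassTwoTable θ₀ θ₁ θ₂ e₀ v k l b r x y := by
  classical
  obtain ⟨e, he1, he2⟩ := hU.nonempty_iso hV₁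
  have hxy := h.inter_sub_ne_zero ℝ
  have het : e₁ * ((x : ℝ) - y) = y - k := by rw [he, div_mul_cancel₀ _ hxy]
  have hmem : ∀ μ ∈ ({e₀, e₁, e₂} : Set ℝ), μ = blockDegree ℝ k b r x y ∨
      μ = blockEigenvalue ℝ k l r x y ∨ μ = e₁ := by
    intro μ hμ
    rw [← hE] at hμ
    rcases h.eq_of_mem_graphEigenvalues hμ with h1 | h1 | h1
    · exact Or.inl h1
    · exact Or.inr (Or.inl h1)
    · exact Or.inr (Or.inr (mul_right_cancel₀ hxy (h1.trans het.symm)))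
  have hd : e₀ = blockDegree ℝ k b r x y := by
    have h1 : e₀ ≤ blockDegree ℝ k b r x y := h.le_blockDegree (by rw [hE]; simp)
    have h2 := h.blockDegree_mem
    rw [hE] at h2
    rcases h2 with h2 | h2 | h2
    · exact h2.symm
    · linarith
    · rw [Set.mem_singleton_iff] at h2
      linarith
  -- The block graph has only three candidate eigenvalues; d = e₀ and (y − k)/(x − y) = e₁ are
  -- taken.
  have hs : e₂ = blockEigenvalue ℝ k l r x y := by
    rcases hmem e₂ (by simp) with h1 | h1 | h1
    · linarith
    · exact h1
    · linarith
  have hS := h.blockEigenvalue_mul (K := ℝ)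
  rw [← hs] at hS
  have hrl : (0 : ℝ) < r - l := sub_pos.2 (Nat.cast_lt.2 h.pair_lt_replication)
  have hr : (0 : ℝ) < r := Nat.cast_pos.2 (Nat.zero_lt_of_lt h.pair_lt_replication)
  have hk : (0 : ℝ) < k := Nat.cast_pos.2 h.one_le_k
  -- The relations for e₂ and e₁ subtract to (e₂ − e₁)(x − y) = r − l > 0.
  have hneg : (x : ℝ) - y < 0 := by
    by_contra! h1
    have : (e₂ - e₁) * ((x : ℝ) - y) ≤ 0 :=
      mul_nonpos_of_nonpos_of_nonneg (by linarith) h1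
    linarith
  have hnn : 0 ≤ e₁ := by
    have : (y : ℝ) ≤ k := Nat.cast_le.2 h.le_block
    rw [he]
    exact div_nonneg_of_nonpos (by linarith) hneg.le
  obtain ⟨p₁, n₁, hn₁, hp₁, hs₁, hm₁, hq₁, hq₁'⟩ :=
    exists_roots_of_pos (blockDegree ℝ k b r x y) (mul_pos hr hk)
  obtain ⟨p₂, n₂, hn₂, hp₂, hs₂, hm₂, hq₂, hq₂'⟩ :=
    exists_roots_of_pos (blockEigenvalue ℝ k l r x y) hrl
  have hT : ∀ {μ}, μ ∈ graphEigenvalues (totalGraph D x) → μ = θ₀ ∨ μ = θ₁ ∨ μ = θ₂ := by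
    intro μ hμ
    rw [graphEigenvalues_eq_of_iso e, hG.eigenvalues_eq] at hμ
    exact hμ
  have g01 := hG.gt₀₁
  have g12 := hG.gt₁₂
  -- A negative root cannot be θ₁ = e₁ ≥ 0, nor the larger θ₀.
  have hz₁ : n₁ = θ₂ := by
    rcases hT (h.mem_graphEigenvalues_totalGraph_of_degree hq₁') with h1 | h1 | h1
    · linarith
    · linarith
    · exact h1
  have hz₂ : n₂ = θ₂ := by
    rcases hT (h.mem_graphEigenvalues_totalGraph_of_eigenvalue hq₂') with h1 | h1 | h1
    · linarith
    · linarith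
    · exact h1
  -- The negative roots agree and the sums of roots are e₂ < e₀. Both positive roots avoid θ₂, so
  -- their order identifies them.
  have hlt : p₂ < p₁ := by linarith
  obtain ⟨hp₁', hp₂'⟩ : p₁ = θ₀ ∧ p₂ = θ₁ := by
    rcases hT (h.mem_graphEigenvalues_totalGraph_of_degree hq₁) with h1 | h1 | h1 <;>
    rcases hT (h.mem_graphEigenvalues_totalGraph_of_eigenvalue hq₂) with h2 | h2 | h2 <;>
    first
      | exact ⟨h1, h2⟩
      | (exfalso; linarith)
  subst hz₁ hp₁' hp₂'
  -- Here e₂ − e₁ is the negative root, so r − l = (e₂ − e₁)(x − y) is compared with the product of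
  -- the roots.
  have hx : (x : ℝ) - y = -p₂ := by
    apply mul_left_cancel₀ hn₁.ne
    have : (p₂ + n₁) * ((x : ℝ) - y) = r - l - k + y := by rw [← hS, hs, ← hs₂, hz₂]
    rw [hz₂] at hm₂
    rw [← hθ] at het
    linear_combination this - het + hm₂
  have hy : (k : ℝ) - y = p₂ ^ 2 := by
    rw [← hθ, hx] at het
    linear_combination het
  have hreg : (r : ℝ) ≠ k + e₀ := by
    obtain ⟨p⟩ := h.nonempty_point
    obtain ⟨j⟩ := h.nonempty_block
    obtain ⟨k₁, k₂, hkk, hV1, hV2, -⟩ := hU.valency_partition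
    have d1 := he1 p
    have d2 := he2 j
    rw [hV1, Set.mem_ofPred_eq] at d1
    rw [hV2, Set.mem_ofPred_eq] at d2
    intro h0
    apply hkk
    rw [hd, ← h.degree_inl p, ← h.degree_inr j, Nat.cast_inj, ← e.degree_eq, ← e.degree_eq] at h0
    rw [← d1, ← d2]
    convert h0
  have hsum : e₀ = p₁ + n₁ := hd.trans hs₁.symm
  obtain ⟨r1, r2⟩ := classTwoTable_of_identities hp₂ hn₁ g01 h.one_le_k
    h.blocks_mul h.mul_replication
    (hd ▸ h.blockDegree_mul (K := ℝ)) (hd ▸ h.mul_blockDegree (K := ℝ)) hsum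
    (by linear_combination hm₁) (by rw [hz₂] at hm₂; linear_combination hm₂) hx hy hreg
  exact ⟨r1, hsum, by rw [hs, ← hs₂, hz₂], r2⟩

theorem totalGraph_inG3 {P B : Type*} [Fintype P] [Fintype B] {D : B → Finset P}
    {v k l b r x y : ℕ} {w z : ℝ} (hw : 0 < w) (hz : z < 0) (h : IsQSD D v k l b r x y)
    (hT : ClassTwoTable (f₂ w z) w z (f₂ w z + z) v k l b r x y) :
    InG3 (totalGraph D x) (f₂ w z) w z := by
  classical
  obtain ⟨hd, hrk, hrl, hx, hy, hlt, hlk⟩ := hT.identities hw hz h.one_le_k h.blockDegree_mul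
  have hs : blockEigenvalue ℝ k l r x y = w + z := by
    have := h.blockEigenvalue_mul (K := ℝ)
    rw [hx] at this
    apply mul_left_cancel₀ (neg_ne_zero.2 hw.ne')
    linear_combination this + hrl - hy
  -- From l·k = z²(w + 1) ≠ 0. Connectedness then follows: two points share a block, and every block
  -- has a point.
  have hl : 0 < l := by
    rw [Nat.pos_iff_ne_zero]
    rintro rfl
    have : 0 < z ^ 2 * (w + 1) := by have := sq_pos_of_neg hz; positivity
    simp at hlk
    rcases hlk with h1 | h1 <;> linarith
  refine ⟨?_, hlt, hz.trans hw, ?_⟩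
  · have hpt : ∀ p q : P, (totalGraph D x).Reachable (Sum.inl p) (Sum.inl q) := by
      intro p q
      by_cases hpq : p = q
      · rw [hpq]
      · have h1 := h.card_blocks_pair p q hpq
        rw [← h1, Finset.card_pos] at hl
        obtain ⟨j, hj⟩ := hl
        rw [Finset.mem_filter] at hj
        have a1 : (totalGraph D x).Adj (Sum.inl p) (Sum.inr j) := hj.2.1
        have a2 : (totalGraph D x).Adj (Sum.inr j) (Sum.inl q) := hj.2.2
        exact a1.reachable.trans a2.reachable
    obtain ⟨p⟩ := h.nonempty_point
    have hall : ∀ u, (totalGraph D x).Reachable (Sum.inl p) u := by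
      rintro (q | j)
      · exact hpt p q
      · obtain ⟨q, hq⟩ := h.exists_mem j
        have a1 : (totalGraph D x).Adj (Sum.inl q) (Sum.inr j) := hq
        exact (hpt p q).trans a1.reachable
    exact (SimpleGraph.connected_iff _).2
      ⟨fun u u' => (hall u).symm.trans (hall u'), ⟨Sum.inl p⟩⟩
  · ext μ
    simp only [Set.mem_insert_iff, Set.mem_singleton_iff]
    constructor
    · intro hμ
      by_cases h1 : μ = w
      · exact Or.inr (Or.inl h1)
      by_cases h2 : μ = z
      · exact Or.inr (Or.inr h2)
      left
      -- The quotient quadratic factors as (μ − f₂)(μ − z).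
      have h3 := h.quotient_of_mem_graphEigenvalues hx hy hrl hw.ne' h1 h2 hμ
      apply sub_eq_zero.1
      apply (mul_eq_zero.1 (?_ : (μ - f₂ w z) * (μ - z) = 0)).resolve_right (sub_ne_zero.2 h2)
      linear_combination h3 + μ * hd + hrk
    · rintro (rfl | rfl | rfl)
      · apply h.mem_graphEigenvalues_totalGraph_of_degree
        rw [hd]
        linear_combination -hrk
      · apply h.mem_graphEigenvalues_totalGraph_of_eigenvalue
        rw [hs]
        linear_combination -hrl
      · apply h.mem_graphEigenvalues_totalGraph_of_eigenvalue
        rw [hs]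
        linear_combination -hrl

/-! ### Coherent algebras from colourings -/

section Colouring

variable {V : Type*} [Fintype V] {n : ℕ}

/-- The matrix with entry `f a` at the pairs of colour `a`. -/
def colourMatrix (c : V → V → Fin n) (f : Fin n → ℂ) : Matrix V V ℂ :=
  Matrix.of fun i j => f (c i j)

@[simp] theorem colourMatrix_apply (c : V → V → Fin n) (f : Fin n → ℂ) (i j : V) :
    colourMatrix c f i j = f (c i j) := rfl

/-- A colour matrix depends linearly on the values at the colours. -/
def colourLinearMap (c : V → V → Fin n) : (Fin n → ℂ) →ₗ[ℂ] Matrix V V ℂ where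
  toFun := colourMatrix c
  map_add' _ _ := rfl
  map_smul' _ _ := rfl

open Classical in
/-- If a colouring of the pairs of vertices is a coherent configuration and its classes are forced
by the graph, then the coherent rank is the number of colours. -/
theorem coherentRank_eq_of_colouring {G : SimpleGraph V} (c : V → V → Fin n)
    (hsurj : ∀ a, ∃ i j, c i j = a)
    (hone : ∃ s : Fin n → Prop, ∀ i j, s (c i j) ↔ i = j)
    (hmul : ∀ f g, ∃ h, colourMatrix c f * colourMatrix c g = colourMatrix c h)
    (htr : ∃ σ : Fin n → Fin n, ∀ i j, c j i = σ (c i j))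
    (hadj : ∃ s : Fin n → Prop, ∀ i j, s (c i j) ↔ G.Adj i j)
    (hmin : ∀ S : Submodule ℂ (Matrix V V ℂ), (∀ M ∈ S, ∀ N ∈ S, M * N ∈ S) →
      (∀ M ∈ S, ∀ N ∈ S, Matrix.hadamard M N ∈ S) →
      (Matrix.of fun i j => if i = j then (1 : ℂ) else 0) ∈ S → allOnes ℂ V V ∈ S →
      G.adjMatrix ℂ ∈ S → ∀ f, colourMatrix c f ∈ S) :
    coherentRank G = n := by
  have hone' : (1 : Matrix V V ℂ) ∈ LinearMap.range (colourLinearMap c) := by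
    obtain ⟨s, hs⟩ := hone
    refine ⟨fun a => if s a then 1 else 0, ?_⟩
    ext i j
    change (if s (c i j) then (1 : ℂ) else 0) = _
    rw [Matrix.one_apply]
    exact if_congr (hs i j) rfl rfl
  let S₀ : Subalgebra ℂ (Matrix V V ℂ) :=
    (LinearMap.range (colourLinearMap c)).toSubalgebra hone' (by
      rintro _ _ ⟨f, rfl⟩ ⟨g, rfl⟩
      obtain ⟨h, hh⟩ := hmul f g
      exact ⟨h, hh.symm⟩)
  have hS₀ : IsCoherentAlgebra S₀ := by
    refine ⟨⟨fun _ => 1, rfl⟩, ?_, ?_⟩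
    · rintro _ ⟨f, rfl⟩
      obtain ⟨σ, hσ⟩ := htr
      refine ⟨f ∘ σ, ?_⟩
      ext i j
      exact congrArg f (hσ i j).symm
    · rintro _ ⟨f, rfl⟩ _ ⟨g, rfl⟩
      exact ⟨f * g, rfl⟩
  have hA : G.adjMatrix ℂ ∈ S₀ := by
    obtain ⟨s, hs⟩ := hadj
    refine ⟨fun a => if s a then 1 else 0, ?_⟩
    ext i j
    change (if s (c i j) then (1 : ℂ) else 0) = _
    rw [SimpleGraph.adjMatrix_apply]
    exact if_congr (hs i j) rfl rfl
  -- The span of the colour classes is a coherent algebra containing A; `hmin` says that every such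
  -- algebra contains it.
  have heq : coherentClosure G = S₀ := by
    apply le_antisymm
    · exact sInf_le ⟨hS₀, hA⟩
    · rintro _ ⟨f, rfl⟩
      refine Algebra.mem_sInf.2 fun S hS => hmin (Subalgebra.toSubmodule S)
        (fun M hM N hN => S.mul_mem hM hN) hS.1.hadamard_mem ?_ hS.1.allOnes_mem hS.2 f
      have h1 : (Matrix.of fun i j => if i = j then (1 : ℂ) else 0) = (1 : Matrix V V ℂ) := by
        ext i j
        rw [Matrix.one_apply]
        rfl
      rw [h1]
      exact S.one_mem
  have hinj : Function.Injective (colourLinearMap c) := by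
    intro f g hfg
    ext a
    obtain ⟨i, j, rfl⟩ := hsurj a
    exact congrFun (congrFun hfg i) j
  rw [coherentRank, heq, ← Subalgebra.finrank_toSubmodule]
  change Module.finrank ℂ (LinearMap.range (colourLinearMap c)) = n
  rw [LinearMap.finrank_range_of_inj hinj, Module.finrank_fin_fun]

end Colouring

/-! ### The coherent rank of the total graph -/

/-- A product of matrices from two spans lies in a submodule that contains the products of the
generators. -/
theorem mul_mem_of_mem_span {K m n o : Type*} [Field K] [Fintype n]
    {s : Set (Matrix m n K)} {t : Set (Matrix n o K)} {U : Submodule K (Matrix m o K)}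
    (h : ∀ a ∈ s, ∀ b ∈ t, a * b ∈ U) {M : Matrix m n K} {N : Matrix n o K}
    (hM : M ∈ Submodule.span K s) (hN : N ∈ Submodule.span K t) : M * N ∈ U := by
  induction hM using Submodule.span_induction with
  | zero => rw [Matrix.zero_mul]; exact U.zero_mem
  | add a a' _ _ ha ha' => rw [Matrix.add_mul]; exact U.add_mem ha ha'
  | smul c a _ ha => rw [Matrix.smul_mul]; exact U.smul_mem c ha
  | mem a ha =>
    induction hN using Submodule.span_induction with
    | zero => rw [Matrix.mul_zero]; exact U.zero_mem
    | add b b' _ _ hb hb' => rw [Matrix.mul_add]; exact U.add_mem hb hb'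
    | smul c b _ hb => rw [Matrix.mul_smul]; exact U.smul_mem c hb
    | mem b hb => exact h a ha b hb

section TotalColour

variable {P B : Type*} [Fintype P] [Fintype B] {D : B → Finset P} {v k l b r x y : ℕ}

open Classical in
/-- The colouring of the pairs of vertices of the total graph. -/
def totalColour (D : B → Finset P) (x : ℕ) : P ⊕ B → P ⊕ B → Fin 9
  | .inl p, .inl q => if p = q then 0 else 1
  | .inl p, .inr j => if p ∈ D j then 2 else 3
  | .inr j, .inl p => if p ∈ D j then 4 else 5
  | .inr i, .inr j => if i = j then 6 else if (D i ∩ D j).card = x then 7 else 8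

open Classical in
/-- The span of the basis matrices indexed by points. -/
def pointSpan (P : Type*) : Submodule ℂ (Matrix P P ℂ) :=
  Submodule.span ℂ {1, allOnes ℂ P P}

/-- The span of the basis matrices indexed by points and blocks. -/
def incidenceSpan (D : B → Finset P) : Submodule ℂ (Matrix P B ℂ) :=
  Submodule.span ℂ {incidence ℂ D, allOnes ℂ P B}

/-- The span of the basis matrices indexed by blocks and points. -/
def transposeSpan (D : B → Finset P) : Submodule ℂ (Matrix B P ℂ) :=
  Submodule.span ℂ {(incidence ℂ D).transpose, allOnes ℂ B P}

open Classical in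
/-- The span of the basis matrices indexed by blocks. -/
def blockSpan (D : B → Finset P) (x : ℕ) : Submodule ℂ (Matrix B B ℂ) :=
  Submodule.span ℂ {1, blockMatrix ℂ D x, allOnes ℂ B B}

open Classical in
theorem one_mem_pointSpan : (1 : Matrix P P ℂ) ∈ pointSpan P := Submodule.subset_span (by simp)

theorem allOnes_mem_pointSpan : allOnes ℂ P P ∈ pointSpan P := Submodule.subset_span (by simp)

theorem incidence_mem_incidenceSpan : incidence ℂ D ∈ incidenceSpan D :=
  Submodule.subset_span (by simp)

theorem allOnes_mem_incidenceSpan : allOnes ℂ P B ∈ incidenceSpan D :=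
  Submodule.subset_span (by simp)

theorem transpose_mem_transposeSpan : (incidence ℂ D).transpose ∈ transposeSpan D :=
  Submodule.subset_span (by simp)

theorem allOnes_mem_transposeSpan : allOnes ℂ B P ∈ transposeSpan D :=
  Submodule.subset_span (by simp)

open Classical in
theorem one_mem_blockSpan : (1 : Matrix B B ℂ) ∈ blockSpan D x := Submodule.subset_span (by simp)

theorem blockMatrix_mem_blockSpan : blockMatrix ℂ D x ∈ blockSpan D x :=
  Submodule.subset_span (by simp)

theorem allOnes_mem_blockSpan : allOnes ℂ B B ∈ blockSpan D x := Submodule.subset_span (by simp)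

open Classical in
theorem colourMatrix_totalColour (D : B → Finset P) (x : ℕ) (f : Fin 9 → ℂ) :
    colourMatrix (totalColour D x) f = Matrix.fromBlocks
      ((f 0 - f 1) • (1 : Matrix P P ℂ) + f 1 • allOnes ℂ P P)
      ((f 2 - f 3) • incidence ℂ D + f 3 • allOnes ℂ P B)
      ((f 4 - f 5) • (incidence ℂ D).transpose + f 5 • allOnes ℂ B P)
      ((f 6 - f 8) • (1 : Matrix B B ℂ) + ((f 7 - f 8) • blockMatrix ℂ D x
        + f 8 • allOnes ℂ B B)) := by
  ext (p | i) (q | j)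
  · by_cases hpq : p = q
    · subst hpq; simp [totalColour]
    · simp [totalColour, hpq, Matrix.one_apply_ne hpq]
  · by_cases hpj : p ∈ D j <;> simp [totalColour, hpj, incidence_apply]
  · by_cases hpj : q ∈ D i <;> simp [totalColour, hpj, incidence_apply]
  · by_cases hij : i = j
    · subst hij; simp [totalColour, blockMatrix_apply]
    · by_cases hx : (D i ∩ D j).card = x <;>
        simp [totalColour, hij, hx, Matrix.one_apply_ne hij, blockMatrix_apply]

theorem exists_colourMatrix_of_mem {M₁ : Matrix P P ℂ}
    {M₂ : Matrix P B ℂ} {M₃ : Matrix B P ℂ} {M₄ : Matrix B B ℂ} (h1 : M₁ ∈ pointSpan P)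
    (h2 : M₂ ∈ incidenceSpan D) (h3 : M₃ ∈ transposeSpan D) (h4 : M₄ ∈ blockSpan D x) :
    ∃ f, Matrix.fromBlocks M₁ M₂ M₃ M₄ = colourMatrix (totalColour D x) f := by
  obtain ⟨a0, a1, rfl⟩ := Submodule.mem_span_pair.1 h1
  obtain ⟨a2, a3, rfl⟩ := Submodule.mem_span_pair.1 h2
  obtain ⟨a4, a5, rfl⟩ := Submodule.mem_span_pair.1 h3
  obtain ⟨a6, a7, a8, rfl⟩ := Submodule.mem_span_triple.1 h4
  -- The value at a colour is the sum of the coefficients of those generators that are 1 there.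
  refine ⟨![a0 + a1, a1, a2 + a3, a3, a4 + a5, a5, a6 + a8, a7 + a8, a8], ?_⟩
  rw [colourMatrix_totalColour]
  simp [Matrix.cons_val, add_assoc]

/-- Blockwise, it suffices to multiply generators. The design identities handle each product; X² is
known only after scaling by x − y, which is nonzero. -/
theorem colourMatrix_mul (h : IsQSD D v k l b r x y) (f g : Fin 9 → ℂ) :
    ∃ e, colourMatrix (totalColour D x) f * colourMatrix (totalColour D x) g
      = colourMatrix (totalColour D x) e := by
  classical
  have hXX : blockMatrix ℂ D x * blockMatrix ℂ D x ∈ blockSpan D x := by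
    rw [← Submodule.smul_mem_iff _ (h.inter_sub_ne_zero ℂ), h.blockMatrix_mul_self]
    exact add_mem (add_mem (Submodule.smul_mem _ _ one_mem_blockSpan)
      (Submodule.smul_mem _ _ blockMatrix_mem_blockSpan))
      (Submodule.smul_mem _ _ allOnes_mem_blockSpan)
  have hf : ∀ f : Fin 9 → ℂ, ∃ (M₁ : Matrix P P ℂ) (M₂ : Matrix P B ℂ) (M₃ : Matrix B P ℂ)
      (M₄ : Matrix B B ℂ), M₁ ∈ pointSpan P ∧ M₂ ∈ incidenceSpan D ∧ M₃ ∈ transposeSpan D ∧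
        M₄ ∈ blockSpan D x ∧
        colourMatrix (totalColour D x) f = Matrix.fromBlocks M₁ M₂ M₃ M₄ := fun f =>
    ⟨_, _, _, _,
      add_mem (Submodule.smul_mem _ _ one_mem_pointSpan)
        (Submodule.smul_mem _ _ allOnes_mem_pointSpan),
      add_mem (Submodule.smul_mem _ _ incidence_mem_incidenceSpan)
        (Submodule.smul_mem _ _ allOnes_mem_incidenceSpan),
      add_mem (Submodule.smul_mem _ _ transpose_mem_transposeSpan)
        (Submodule.smul_mem _ _ allOnes_mem_transposeSpan),
      add_mem (Submodule.smul_mem _ _ one_mem_blockSpan)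
        (add_mem (Submodule.smul_mem _ _ blockMatrix_mem_blockSpan)
          (Submodule.smul_mem _ _ allOnes_mem_blockSpan)),
      colourMatrix_totalColour D x f⟩
  obtain ⟨M₁, M₂, M₃, M₄, m1, m2, m3, m4, hM⟩ := hf f
  obtain ⟨N₁, N₂, N₃, N₄, n1, n2, n3, n4, hN⟩ := hf g
  rw [hM, hN, Matrix.fromBlocks_multiply]
  apply exists_colourMatrix_of_mem
  · refine add_mem (mul_mem_of_mem_span ?_ m1 n1) (mul_mem_of_mem_span ?_ m2 n3)
    · rintro a (rfl | rfl) b (rfl | rfl)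
      all_goals
        simp only [Matrix.mul_one, Matrix.one_mul, allOnes_mul_allOnes]
        first
          | exact one_mem_pointSpan
          | exact allOnes_mem_pointSpan
          | exact Submodule.smul_mem _ _ allOnes_mem_pointSpan
    · rintro a (rfl | rfl) b (rfl | rfl)
      all_goals
        simp only [h.incidence_mul_transpose, h.incidence_mul_allOnes, h.allOnes_mul_transpose,
          allOnes_mul_allOnes]
        first
          | exact Submodule.smul_mem _ _ allOnes_mem_pointSpan
          | exact add_mem (Submodule.smul_mem _ _ one_mem_pointSpan)
              (Submodule.smul_mem _ _ allOnes_mem_pointSpan)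
  · refine add_mem (mul_mem_of_mem_span ?_ m1 n2) (mul_mem_of_mem_span ?_ m2 n4)
    · rintro a (rfl | rfl) b (rfl | rfl)
      all_goals
        simp only [Matrix.one_mul, allOnes_mul_allOnes, h.allOnes_mul_incidence]
        first
          | exact incidence_mem_incidenceSpan
          | exact allOnes_mem_incidenceSpan
          | exact Submodule.smul_mem _ _ allOnes_mem_incidenceSpan
    · rintro a (rfl | rfl) b (rfl | rfl | rfl)
      all_goals
        simp only [Matrix.mul_one, allOnes_mul_allOnes, h.incidence_mul_blockMatrix,
          h.incidence_mul_allOnes, h.allOnes_mul_blockMatrix]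
        first
          | exact incidence_mem_incidenceSpan
          | exact allOnes_mem_incidenceSpan
          | exact Submodule.smul_mem _ _ allOnes_mem_incidenceSpan
          | exact add_mem (Submodule.smul_mem _ _ incidence_mem_incidenceSpan)
              (Submodule.smul_mem _ _ allOnes_mem_incidenceSpan)
  · refine add_mem (mul_mem_of_mem_span ?_ m3 n1) (mul_mem_of_mem_span ?_ m4 n3)
    · rintro a (rfl | rfl) b (rfl | rfl)
      all_goals
        simp only [Matrix.mul_one, allOnes_mul_allOnes, h.transpose_mul_allOnes]
        first
          | exact transpose_mem_transposeSpan
          | exact allOnes_mem_transposeSpan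
          | exact Submodule.smul_mem _ _ allOnes_mem_transposeSpan
    · rintro a (rfl | rfl | rfl) b (rfl | rfl)
      all_goals
        simp only [Matrix.one_mul, allOnes_mul_allOnes, h.blockMatrix_mul_transpose,
          h.allOnes_mul_transpose, h.blockMatrix_mul_allOnes]
        first
          | exact transpose_mem_transposeSpan
          | exact allOnes_mem_transposeSpan
          | exact Submodule.smul_mem _ _ allOnes_mem_transposeSpan
          | exact add_mem (Submodule.smul_mem _ _ transpose_mem_transposeSpan)
              (Submodule.smul_mem _ _ allOnes_mem_transposeSpan)
  · refine add_mem (mul_mem_of_mem_span ?_ m3 n2) (mul_mem_of_mem_span ?_ m4 n4)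
    · rintro a (rfl | rfl) b (rfl | rfl)
      all_goals
        simp only [h.transpose_mul_incidence, h.transpose_mul_allOnes, h.allOnes_mul_incidence,
          allOnes_mul_allOnes]
        first
          | exact Submodule.smul_mem _ _ allOnes_mem_blockSpan
          | exact add_mem (add_mem (Submodule.smul_mem _ _ one_mem_blockSpan)
              (Submodule.smul_mem _ _ blockMatrix_mem_blockSpan))
              (Submodule.smul_mem _ _ allOnes_mem_blockSpan)
    · rintro a (rfl | rfl | rfl) b (rfl | rfl | rfl)
      all_goals
        first
          | exact hXX
          | simp only [Matrix.one_mul, Matrix.mul_one, allOnes_mul_allOnes,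
              h.blockMatrix_mul_allOnes, h.allOnes_mul_blockMatrix]
        try first
          | exact one_mem_blockSpan
          | exact blockMatrix_mem_blockSpan
          | exact allOnes_mem_blockSpan
          | exact Submodule.smul_mem _ _ allOnes_mem_blockSpan

open Classical in
theorem totalColour_surjective (h : IsQSD D v k l b r x y) (a : Fin 9) :
    ∃ i j, totalColour D x i j = a := by
  obtain ⟨j⟩ := h.nonempty_block
  obtain ⟨p, hp⟩ := h.exists_mem j
  obtain ⟨q, hq⟩ := h.exists_not_mem j
  have hpq : p ≠ q := fun e => hq (e ▸ hp)
  obtain ⟨i₁, j₁, hij₁, hx⟩ := h.x_occurs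
  obtain ⟨i₂, j₂, hij₂, hy⟩ := h.y_occurs
  have hyx : (D i₂ ∩ D j₂).card ≠ x := by
    intro e
    exact h.x_ne_y (e.symm.trans hy)
  fin_cases a
  · exact ⟨.inl p, .inl p, if_pos rfl⟩
  · exact ⟨.inl p, .inl q, if_neg hpq⟩
  · exact ⟨.inl p, .inr j, if_pos hp⟩
  · exact ⟨.inl q, .inr j, if_neg hq⟩
  · exact ⟨.inr j, .inl p, if_pos hp⟩
  · exact ⟨.inr j, .inl q, if_neg hq⟩
  · exact ⟨.inr j, .inr j, if_pos rfl⟩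
  · exact ⟨.inr i₁, .inr j₁, (if_neg hij₁).trans (if_pos hx)⟩
  · exact ⟨.inr i₂, .inr j₂, (if_neg hij₂).trans (if_neg hyx)⟩

open Classical in
/-- A matrix space closed under both products that contains the adjacency matrix of the total graph
separates points from blocks when their degrees differ. -/
theorem colourMatrix_totalColour_mem (h : IsQSD D v k l b r x y)
    (hreg : (r : ℝ) ≠ k + blockDegree ℝ k b r x y) {S : Submodule ℂ (Matrix (P ⊕ B) (P ⊕ B) ℂ)}
    (hmul : ∀ M ∈ S, ∀ N ∈ S, M * N ∈ S) (hhad : ∀ M ∈ S, ∀ N ∈ S, Matrix.hadamard M N ∈ S)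
    (hI : (Matrix.of fun i j => if i = j then (1 : ℂ) else 0) ∈ S) (hJ' : allOnes ℂ (P ⊕ B) (P ⊕ B) ∈ S)
    (hA : Matrix.fromBlocks 0 (incidence ℂ D) (incidence ℂ D).transpose (blockMatrix ℂ D x) ∈ S)
    (f : Fin 9 → ℂ) : colourMatrix (totalColour D x) f ∈ S := by
  obtain ⟨j₀⟩ := h.nonempty_block
  set e : ℕ := (totalGraph D x).degree (Sum.inr j₀) with he
  have hre : (r : ℂ) - e ≠ 0 := by
    rw [sub_ne_zero, Ne, Nat.cast_inj]
    intro h0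
    apply hreg
    rw [← h.degree_inr j₀, ← he, h0]
  have hdl : ∀ p, (totalGraph D x).degree (Sum.inl p) = r := fun p => by
    exact_mod_cast h.degree_inl p
  have hdr : ∀ j, (totalGraph D x).degree (Sum.inr j) = e := fun j => by
    have := (h.degree_inr j).trans (h.degree_inr j₀).symm
    exact_mod_cast this
  have hone : Matrix.fromBlocks (1 : Matrix P P ℂ) 0 0 (1 : Matrix B B ℂ) ∈ S := by
    convert hI
    ext (_ | _) (_ | _) <;> simp [Matrix.one_apply]
  have hJ : Matrix.fromBlocks (allOnes ℂ P P) (allOnes ℂ P B) (allOnes ℂ B P) (allOnes ℂ B B)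
      ∈ S := by
    convert hJ'
    ext (_ | _) (_ | _) <;> rfl
  -- The entrywise product of I and A² is the diagonal matrix of degrees.
  have hdeg : Matrix.fromBlocks ((r : ℂ) • (1 : Matrix P P ℂ)) 0 0 ((e : ℂ) • (1 : Matrix B B ℂ))
      ∈ S := by
    convert hhad _ hone _ (hmul _ hA _ hA) using 1
    have hsq : ∀ u, (Matrix.fromBlocks 0 (incidence ℂ D) (incidence ℂ D).transpose
        (blockMatrix ℂ D x) * Matrix.fromBlocks 0 (incidence ℂ D) (incidence ℂ D).transpose
        (blockMatrix ℂ D x)) u u = (totalGraph D x).degree u := fun u => by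
      rw [← totalGraph_adjMatrix_eq_fromBlocks, SimpleGraph.adjMatrix_mul_self_apply_self]
    ext (p | i) (q | j)
    · by_cases hpq : p = q
      · subst hpq
        rw [Matrix.hadamard_apply, hsq, hdl]
        simp
      · simp [hpq, Matrix.one_apply_ne hpq]
    · simp
    · simp
    · by_cases hij : i = j
      · subst hij
        rw [Matrix.hadamard_apply, hsq, hdr]
        simp
      · simp [hij, Matrix.one_apply_ne hij]
  -- Subtracting e·I and dividing by r − e isolates the projection onto the points.
  have hE : Matrix.fromBlocks (1 : Matrix P P ℂ) 0 0 (0 : Matrix B B ℂ) ∈ S := by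
    convert S.smul_mem ((r : ℂ) - e)⁻¹ (S.sub_mem hdeg (S.smul_mem (e : ℂ) hone)) using 1
    rw [eq_inv_smul_iff₀ hre]
    ext (p | i) (q | j)
    · by_cases hpq : p = q <;> simp [hpq]
    all_goals simp [Matrix.one_apply]
  have hF : Matrix.fromBlocks (0 : Matrix P P ℂ) 0 0 (1 : Matrix B B ℂ) ∈ S := by
    convert S.sub_mem hone hE using 1
    rw [sub_eq_add_neg, Matrix.fromBlocks_neg, Matrix.fromBlocks_add]
    simp
  -- Sandwiching between the two projections extracts each of the four blocks.
  have hcut : ∀ {M₁ : Matrix P P ℂ} {M₂ : Matrix P B ℂ} {M₃ : Matrix B P ℂ} {M₄ : Matrix B B ℂ},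
      Matrix.fromBlocks M₁ M₂ M₃ M₄ ∈ S →
        Matrix.fromBlocks M₁ 0 0 0 ∈ S ∧ Matrix.fromBlocks 0 M₂ 0 0 ∈ S ∧
        Matrix.fromBlocks 0 0 M₃ 0 ∈ S ∧ Matrix.fromBlocks 0 0 0 M₄ ∈ S := by
    intro M₁ M₂ M₃ M₄ hM
    refine ⟨?_, ?_, ?_, ?_⟩
    · convert hmul _ (hmul _ hE _ hM) _ hE using 1
      simp [Matrix.fromBlocks_multiply]
    · convert hmul _ (hmul _ hE _ hM) _ hF using 1
      simp [Matrix.fromBlocks_multiply]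
    · convert hmul _ (hmul _ hF _ hM) _ hE using 1
      simp [Matrix.fromBlocks_multiply]
    · convert hmul _ (hmul _ hF _ hM) _ hF using 1
      simp [Matrix.fromBlocks_multiply]
  obtain ⟨-, a2, a3, a4⟩ := hcut hA
  obtain ⟨j1, j2, j3, j4⟩ := hcut hJ
  have hsum := S.add_mem
    (S.add_mem (S.add_mem (S.smul_mem (f 0 - f 1) hE) (S.smul_mem (f 1) j1))
      (S.add_mem (S.smul_mem (f 2 - f 3) a2) (S.smul_mem (f 3) j2)))
    (S.add_mem (S.add_mem (S.smul_mem (f 4 - f 5) a3) (S.smul_mem (f 5) j3))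
      (S.add_mem (S.smul_mem (f 6 - f 8) hF)
        (S.add_mem (S.smul_mem (f 7 - f 8) a4) (S.smul_mem (f 8) j4))))
  rw [colourMatrix_totalColour]
  convert hsum using 1
  simp [Matrix.fromBlocks_smul, Matrix.fromBlocks_add]

theorem coherentRank_totalGraph (h : IsQSD D v k l b r x y)
    (hreg : (r : ℝ) ≠ k + blockDegree ℝ k b r x y) : coherentRank (totalGraph D x) = 9 := by
  classical
  -- Colours 0 and 6 form the diagonal, transposition exchanges 2 with 4 and 3 with 5, and the edges
  -- are the pairs of colours 2, 4 and 7.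
  refine coherentRank_eq_of_colouring (totalColour D x) (totalColour_surjective h)
    ⟨fun a => a = 0 ∨ a = 6, ?_⟩ (colourMatrix_mul h) ⟨![0, 1, 4, 5, 2, 3, 6, 7, 8], ?_⟩
    ⟨fun a => a = 2 ∨ a = 4 ∨ a = 7, ?_⟩ fun S hmul hhad hI hJ hA f => ?_
  · rintro (p | i) (q | j)
    · by_cases hpq : p = q <;> simp [totalColour, hpq]
    · by_cases hpj : p ∈ D j <;> simp [totalColour, hpj]
    · by_cases hpj : q ∈ D i <;> simp [totalColour, hpj]
    · by_cases hij : i = j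
      · simp [totalColour, hij]
      · by_cases hx : (D i ∩ D j).card = x <;> simp [totalColour, hij, hx]
  · rintro (p | i) (q | j)
    · by_cases hpq : p = q
      · simp [totalColour, hpq]
      · simp [totalColour, hpq, Ne.symm hpq]
    · by_cases hpj : p ∈ D j <;> simp [totalColour, hpj]
    · by_cases hpj : q ∈ D i <;> simp [totalColour, hpj]
    · by_cases hij : i = j
      · simp [totalColour, hij]
      · by_cases hx : (D i ∩ D j).card = x <;>
          simp [totalColour, hij, Ne.symm hij, hx, Finset.inter_comm (D j)]
  · rintro (p | i) (q | j)
    · by_cases hpq : p = q <;> simp [totalColour, hpq, totalGraph, totalAdj]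
    · by_cases hpj : p ∈ D j <;> simp [totalColour, hpj, totalGraph, totalAdj]
    · by_cases hpj : q ∈ D i <;> simp [totalColour, hpj, totalGraph, totalAdj]
    · by_cases hij : i = j
      · simp [totalColour, hij, totalGraph]
      · by_cases hx : (D i ∩ D j).card = x <;>
          simp [totalColour, hij, hx, totalGraph, totalAdj, blockGraph]
  · rw [totalGraph_adjMatrix_eq_fromBlocks] at hA
    refine colourMatrix_totalColour_mem h hreg hmul hhad ?_ hJ hA f
    convert hI

end TotalColour

end

theorem lemma5p10 :
    (∀ {V P B : Type*} [Fintype V] [Fintype P] [Fintype B]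
      (G : SimpleGraph V) (θ₀ θ₁ θ₂ : ℝ) (V₁ V₂ : Set V)
      (D : B → Finset P) (v k l b r x y : ℕ) (e₀ e₁ e₂ : ℝ),
      InG3 G θ₀ θ₁ θ₂ →
      coherentRank G = 9 →
      IsQSD D v k l b r x y →
      IsUnderlyingQSD G V₁ V₂ D x →
      e₀ > e₁ → e₁ > e₂ → graphEigenvalues (blockGraph D x) = {e₀, e₁, e₂} →
      G.induce V₁ = ⊥ →
      θ₁ = e₁ → e₁ = ((y : ℝ) - k) / ((x : ℝ) - y) →
        θ₀ = f₂ θ₁ θ₂ ∧ e₀ = θ₀ + θ₂ ∧ e₂ = θ₁ + θ₂ ∧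
        ClassTwoTable θ₀ θ₁ θ₂ e₀ v k l b r x y) ∧
    (∀ {P B : Type*} [Fintype P] [Fintype B]
      (D : B → Finset P) (v k l b r x y : ℕ) (θ₁ θ₂ : ℤ),
      1 ≤ θ₁ → θ₂ ≤ -2 →
      IsQSD D v k l b r x y →
      ClassTwoTable (f₂ θ₁ θ₂) θ₁ θ₂ (f₂ θ₁ θ₂ + θ₂) v k l b r x y →
        InG3 (totalGraph D x) (f₂ θ₁ θ₂) θ₁ θ₂ ∧
        ((r : ℝ) ≠ k + f₂ θ₁ θ₂ + θ₂ → coherentRank (totalGraph D x) = 9)) := by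
  constructor
  · intro V P B _ _ _ G θ₀ θ₁ θ₂ V₁ V₂ D v k l b r x y e₀ e₁ e₂ hG _ h hU h01 h12 hE hV₁ hθ he
    exact three_eigenvalue_parameters hG h hU h01 h12 hE hV₁ hθ he
  · intro P B _ _ D v k l b r x y θ₁ θ₂ h1 h2 h hT
    have hw : (0 : ℝ) < θ₁ := Int.cast_pos.2 (by omega)
    have hz : (θ₂ : ℝ) < 0 := Int.cast_lt_zero.2 (by omega)
    refine ⟨totalGraph_inG3 hw hz h hT, fun hreg => coherentRank_totalGraph h ?_⟩
    rwa [(hT.identities hw hz h.one_le_k h.blockDegree_mul).1, ← add_assoc]
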